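/- Let $A$ be a local principal ideal commutative ring with maximal ideal $\mathfrak m$, and suppose that the residue field $A/\mathfrak m$ is finite with $q$ elements. Let $\ell\in\mathbb N\cup\{\infty\}$ be the length of $A$, that is, the smallest positive integer with $\mathfrak m^{\ell}=0$, or $\infty$ if there is none, and put $A_i=A/\mathfrak m^i$. For a commutative ring $R$, matrices $\alpha,\alpha'\in \mathrm M_3(R)$ are similar if $X\alpha=\alpha'X$ for some $X\in\mathrm{GL}_3(R)$; the similarity classes in $\mathrm{GL}_3(R)$ are its conjugacy classes. (1) For every integer $i$ with $1\le i\le \ell$, the number of similarity classes in $\mathrm M_3(A_i)$ is $$s_{\mathrm M_3}(i)=\frac{q^{3i+3}+q^{3i-1}-q^{2i+2}-q^{2i+1}-q^{2i}-q^{2i-1}+2q^{i}}{(q-1)(q^2-1)},$$ and the number of similarity classes in $\mathrm{GL}_3(A_i)$ is $$s_{\mathrm{GL}_3}(i)=\frac{q^{3i+2}-q^{3i}+2q^{3i-2}-q^{2i+1}-q^{2i-1}-2q^{2i-2}+2q^{i-1}}{q^2-1}.$$ (2) Suppose $\ell=\infty$, and set $s_{\mathrm M_3}(0)=1$ and $s_{\mathrm{GL}_3}(0)=1-q^{-1}$,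 the values of these two expressions at $i=0$ (the first is also the number of similarity classes in $\mathrm M_3(A_0)$ for the zero ring $A_0=A/\mathfrak m^0$). Then, as formal power series in $z$ over $\mathbb Q$, $$\sum_{i\ge 0}s_{\mathrm M_3}(i)z^i=\frac{1}{(q-1)(q^2-1)}\left(\frac{q^3+q^{-1}}{1-q^3z}-\frac{q^2+q+1+q^{-1}}{1-q^2z}+\frac{2}{1-qz}\right),$$ $$\sum_{i\ge 0}s_{\mathrm{GL}_3}(i)z^i=\frac{1}{q^2-1}\left(\frac{q^2-1+2q^{-2}}{1-q^3z}-\frac{q+q^{-1}+2q^{-2}}{1-q^2z}+\frac{2q^{-1}}{1-qz}\right).$$ (3) In particular these numbers depend only on $q$: if $B$ is another local principal ideal commutative ring, with maximal ideal $\mathfrak n$, whose residue field has $q$ elements, and $i\ge 1$ is at most the length of $A$ and the length of $B$, then $\mathrm M_3(A_i)$ and $\mathrm M_3(B/\mathfrak n^i)$ have the same number of similarity classes, and so do $\mathrm{GL}_3(A_i)$ and $\mathrm{GL}_3(B/\mathfrak n^i)$. -/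

import Mathlib

open scoped Matrix

/-- The number of similarity classes in `M_3(R)`. For matrices `α, α'`, the relation `IsConj α α'`
underlying `ConjClasses` says that `X * α = α' * X` for some unit `X` of `M_3(R)`, that is, for some
`X ∈ GL_3(R)`. -/
noncomputable def numSimM3 (R : Type*) [CommRing R] : ℕ :=
  Nat.card (ConjClasses (Matrix (Fin 3) (Fin 3) R))

/-- The number of similarity classes in `GL_3(R)`, i.e. of conjugacy classes of this group. -/
noncomputable def numSimGL3 (R : Type*) [CommRing R] : ℕ :=
  Nat.card (ConjClasses (Matrix.GeneralLinearGroup (Fin 3) R))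

/-- The length of a local ring `A` with maximal ideal `𝔪`: the smallest positive integer `ℓ` with
`𝔪 ^ ℓ = 0`, and `∞` if there is none. -/
noncomputable def localLength (A : Type*) [CommRing A] [IsLocalRing A] : ℕ∞ :=
  ⨅ (n : ℕ) (_ : 0 < n ∧ IsLocalRing.maximalIdeal A ^ n = ⊥), (n : ℕ∞)

/-- The finite level quotient `A_i = A / 𝔪 ^ i` of a local ring `A` with maximal ideal `𝔪`. -/
abbrev LevelQuotient (A : Type*) [CommRing A] [IsLocalRing A] (i : ℕ) : Type _ :=
  A ⧸ (IsLocalRing.maximalIdeal A ^ i)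

/-- The formal geometric series `1 / (1 - a z)` over `ℚ`. -/
noncomputable def geomSeries (a : ℚ) : PowerSeries ℚ :=
  (1 - PowerSeries.C a * PowerSeries.X)⁻¹

/-! Since `i` is at most the length of `A`, the ring `A_i` is local with maximal ideal generated by
some `ϖ`, `ϖ ^ i = 0` and no smaller power vanishes; every element is a unit times a power of `ϖ`.
Over such a ring of length `ℓ`, the classes are counted through explicit normal forms.

Existence (`exists_isConj_normalForm`). Write `α = d + ϖ ^ j β` with `j` maximal. If `j < ℓ`, then
`β` is not scalar modulo `ϖ`, so some `v, β v, w` form a basis; after a scalar shift, `β` becomes a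
matrix with three free entries besides its trace. Extracting their largest common power `ϖ ^ k`
gives `kernelMatrix`, which modulo `ϖ ^ k` is a column times a row. With `j + k + a = ℓ`, a further
change of basis makes `p = 1`, or else `z = 1` with `x, y, p` non-units and `k, a > 0`.

Uniqueness (`normalForm_params_unique`). The exponent `j` measures how far `α` is scalar, and `k`
how far the rest is a column times a row. The element `d` is determined modulo `ϖ ^ (j + k)`, and
the characteristic polynomial of `K` gives `y` modulo `ϖ ^ (k + a)` and `x` modulo `ϖ ^ a`. Finally
`D = ϖ⁻ᵏ (K ^ 2 - y K) - x` is intertwined along with `K`; the relation `D ^ 2 + x D = p z (K - y)`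
recovers `p z` modulo `ϖ ^ a`, and comparing `K` and `D` modulo `ϖ` separates the two shapes.

Counting. For fixed `j, k, a` the first shape contributes `q ^ (j + 2k + 3a)` classes and the second
`q ^ (j + 2k + 3a - 3)` when `k, a > 0`. Modulo `ϖ` the determinant is `d ^ 2 (d + ϖ ^ j y)` unless
`j = k = 0`, where `d = 0` and it is `p z`; this selects the invertible forms. What remains is to
sum geometric series. -/

section

open IsLocalRing

/-- `R` is a local ring whose maximal ideal is generated by `ϖ`, and `ℓ` is the smallest exponent
with `ϖ ^ ℓ = 0`. -/
structure IsUniserialOfLength (R : Type*) [CommRing R] [IsLocalRing R] (ϖ : R) (ℓ : ℕ) : Prop where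
  maximalIdeal_eq : maximalIdeal R = Ideal.span {ϖ}
  pow_eq_zero : ϖ ^ ℓ = 0
  pow_ne_zero : ∀ n < ℓ, ϖ ^ n ≠ 0

/-! ### Divisibility and cancellation of powers of the uniformizer. -/

namespace IsUniserialOfLength

variable {R : Type*} [CommRing R] [IsLocalRing R] {ϖ : R} {ℓ : ℕ}

theorem not_isUnit_iff (h : IsUniserialOfLength R ϖ ℓ) {r : R} : ¬ IsUnit r ↔ ϖ ∣ r := by
  rw [← Ideal.mem_span_singleton, ← h.maximalIdeal_eq, mem_maximalIdeal, mem_nonunits_iff]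

theorem residue_eq_zero (h : IsUniserialOfLength R ϖ ℓ) : residue R ϖ = 0 := by
  rw [residue_eq_zero_iff, h.maximalIdeal_eq]
  exact Ideal.mem_span_singleton_self ϖ

/-- If `n < m`, then `ϖ ^ n (1 - ϖ ^ (m - n) c) = 0` with a unit as second factor, so `ϖ ^ n = 0`,
against the minimality of `ℓ`. -/
theorem le_of_pow_dvd_pow (h : IsUniserialOfLength R ϖ ℓ) {m n : ℕ} (hm : m ≤ ℓ)
    (hd : ϖ ^ m ∣ ϖ ^ n) : m ≤ n := by
  by_contra! hlt
  obtain ⟨c, hc⟩ := hd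
  have hu : IsUnit (1 - ϖ ^ (m - n) * c) := by
    by_contra hn
    rw [h.not_isUnit_iff] at hn
    have h1 : ϖ ∣ ϖ ^ (m - n) * c := (dvd_pow_self ϖ (by omega)).mul_right c
    have : ϖ ∣ 1 := by simpa using dvd_add hn h1
    exact h.not_isUnit_iff.2 this isUnit_one
  refine h.pow_ne_zero n (by omega) ((hu.mul_left_eq_zero).1 ?_)
  have : ϖ ^ m = ϖ ^ n * ϖ ^ (m - n) := by rw [← pow_add]; congr 1; omega
  rw [this] at hc
  linear_combination hc

/-- Otherwise `r` is a unit times `ϖ ^ (i - 1)` with `i ≤ n`, and `ϖ ^ (m + i - 1)` would vanish. -/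
theorem dvd_of_pow_mul_eq_zero (h : IsUniserialOfLength R ϖ ℓ) {m n : ℕ} (hmn : m + n = ℓ) {r : R}
    (hr : ϖ ^ m * r = 0) : ϖ ^ n ∣ r := by
  by_contra hnd
  have hex : ∃ i, ¬ ϖ ^ i ∣ r := ⟨n, hnd⟩
  classical
  have hs := Nat.find_spec hex
  set i := Nat.find hex with hi
  have hin : i ≤ n := Nat.find_min' hex hnd
  have hi0 : i ≠ 0 := fun h0 => hs (by rw [h0, pow_zero]; exact one_dvd r)
  obtain ⟨c, hc⟩ : ϖ ^ (i - 1) ∣ r := by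
    by_contra hcon
    have := Nat.find_min' hex hcon
    omega
  have hcu : IsUnit c := by
    by_contra hcn
    obtain ⟨e, he⟩ := h.not_isUnit_iff.1 hcn
    refine hs ⟨e, ?_⟩
    rw [hc, he, ← mul_assoc, ← pow_succ]
    congr 2; omega
  refine h.pow_ne_zero (m + (i - 1)) (by omega) ((hcu.mul_left_eq_zero).1 ?_)
  rw [pow_add, mul_assoc, ← hc, hr]

theorem pow_mul_eq_zero_iff (h : IsUniserialOfLength R ϖ ℓ) {m n : ℕ} (hmn : m + n = ℓ) {r : R} :
    ϖ ^ m * r = 0 ↔ ϖ ^ n ∣ r := by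
  refine ⟨h.dvd_of_pow_mul_eq_zero hmn, ?_⟩
  rintro ⟨c, rfl⟩
  rw [← mul_assoc, ← pow_add, hmn, h.pow_eq_zero, zero_mul]

theorem dvd_of_pow_mul_dvd (h : IsUniserialOfLength R ϖ ℓ) {m n : ℕ} (hmn : m + n ≤ ℓ) {r : R}
    (hr : ϖ ^ (m + n) ∣ ϖ ^ m * r) : ϖ ^ n ∣ r := by
  obtain ⟨c, hc⟩ := hr
  have h0 : ϖ ^ m * (r - ϖ ^ n * c) = 0 := by rw [mul_sub, hc]; ring
  have h1 := h.dvd_of_pow_mul_eq_zero (n := ℓ - m) (by omega) h0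
  have h2 := (pow_dvd_pow ϖ (show n ≤ ℓ - m by omega)).trans h1
  simpa using dvd_add h2 (Dvd.intro c rfl : ϖ ^ n ∣ ϖ ^ n * c)

theorem residue_surjInv_add (h : IsUniserialOfLength R ϖ ℓ) (c : ResidueField R) (t : R) :
    residue R (Function.surjInv residue_surjective c + ϖ * t) = c := by
  rw [map_add, Function.surjInv_eq residue_surjective, map_mul, h.residue_eq_zero, zero_mul,
    add_zero]

/-- Uniqueness of the leading digit of a `ϖ`-adic expansion, at the cost of one level of precision
for the tail. -/
theorem surjInv_add_inj (h : IsUniserialOfLength R ϖ ℓ) {c c' : ResidueField R} {t t' : R} {n : ℕ}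
    (hn : n + 1 ≤ ℓ)
    (hd : ϖ ^ (n + 1) ∣ (Function.surjInv residue_surjective c + ϖ * t) -
      (Function.surjInv residue_surjective c' + ϖ * t')) : c = c' ∧ ϖ ^ n ∣ t - t' := by
  have hc : c = c' := by
    have h1 : ϖ ∣ _ := (dvd_pow_self ϖ n.succ_ne_zero).trans hd
    rw [← h.not_isUnit_iff, ← residue_ne_zero_iff_isUnit, not_not, map_sub,
      h.residue_surjInv_add, h.residue_surjInv_add, sub_eq_zero] at h1
    exact h1
  refine ⟨hc, h.dvd_of_pow_mul_dvd (m := 1) (by omega) ?_⟩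
  subst hc
  rw [pow_one, add_comm 1 n]
  convert hd using 1
  ring

end IsUniserialOfLength

/-! ### Representatives modulo powers of the uniformizer. -/

section Transversal

variable {R : Type*} [CommRing R] [IsLocalRing R]

open Classical in
/-- A set of representatives of `R` modulo `ϖ ^ n`, made of `ϖ`-adic expansions. -/
noncomputable def transversal [Finite (ResidueField R)] (ϖ : R) : ℕ → Finset R
  | 0 => {0}
  | n + 1 =>
    letI := Fintype.ofFinite (ResidueField R)
    ((Finset.univ : Finset (ResidueField R)) ×ˢ transversal ϖ n).image
      fun s => Function.surjInv residue_surjective s.1 + ϖ * s.2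

variable [Finite (ResidueField R)] {ϖ : R} {ℓ : ℕ}

theorem mem_transversal_succ {n : ℕ} {r : R} : r ∈ transversal ϖ (n + 1) ↔
    ∃ c : ResidueField R, ∃ t ∈ transversal ϖ n,
      Function.surjInv residue_surjective c + ϖ * t = r := by
  simp [transversal]

theorem mem_transversal_zero {r : R} : r ∈ transversal ϖ 0 ↔ r = 0 := by
  simp [transversal]

namespace IsUniserialOfLength

theorem exists_transversal (h : IsUniserialOfLength R ϖ ℓ) (n : ℕ) (r : R) :
    ∃ t ∈ transversal ϖ n, ϖ ^ n ∣ r - t := by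
  induction n generalizing r with
  | zero => exact ⟨0, mem_transversal_zero.2 rfl, by simp⟩
  | succ n ih =>
    have hd : ϖ ∣ r - Function.surjInv residue_surjective (residue R r) := by
      rw [← h.not_isUnit_iff, ← residue_ne_zero_iff_isUnit, not_not, map_sub,
        Function.surjInv_eq residue_surjective, sub_self]
    obtain ⟨s, hs⟩ := hd
    obtain ⟨t, ht, e, he⟩ := ih s
    refine ⟨_, mem_transversal_succ.2 ⟨residue R r, t, ht, rfl⟩, e, ?_⟩
    rw [pow_succ]
    linear_combination hs + ϖ * he

theorem eq_of_mem_transversal (h : IsUniserialOfLength R ϖ ℓ) {n : ℕ} (hn : n ≤ ℓ) {t t' : R}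
    (ht : t ∈ transversal ϖ n) (ht' : t' ∈ transversal ϖ n) (hd : ϖ ^ n ∣ t - t') : t = t' := by
  induction n generalizing t t' with
  | zero => rw [mem_transversal_zero.1 ht, mem_transversal_zero.1 ht']
  | succ n ih =>
    obtain ⟨c, s, hs, rfl⟩ := mem_transversal_succ.1 ht
    obtain ⟨c', s', hs', rfl⟩ := mem_transversal_succ.1 ht'
    obtain ⟨rfl, h2⟩ := h.surjInv_add_inj hn hd
    rw [ih (by omega) hs hs' h2]

theorem card_transversal (h : IsUniserialOfLength R ϖ ℓ) {n : ℕ} (hn : n ≤ ℓ) :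
    (transversal ϖ n).card = Nat.card (ResidueField R) ^ n := by
  classical
  induction n with
  | zero => simp [transversal]
  | succ n ih =>
    let _ := Fintype.ofFinite (ResidueField R)
    rw [transversal, Finset.card_image_of_injOn, Finset.card_product, ih (by omega),
      Finset.card_univ, Nat.card_eq_fintype_card, pow_succ, mul_comm]
    rintro ⟨c, t⟩ hs ⟨c', t'⟩ hs' he
    simp only [Finset.coe_product, Set.mem_prod, Finset.mem_coe] at hs hs'
    have := h.surjInv_add_inj hn (sub_eq_zero.2 he ▸ dvd_zero _)
    exact Prod.ext this.1 (h.eq_of_mem_transversal (by omega) hs.2 hs'.2 this.2)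

-- The first digit is forced to be the negative of the residue of `e`, and the other `n` digits are
-- free.
open Classical in
theorem card_filter_not_isUnit_add (h : IsUniserialOfLength R ϖ ℓ) {n : ℕ} (hn : n + 1 ≤ ℓ)
    (e : R) : ((transversal ϖ (n + 1)).filter fun r => ¬ IsUnit (e + r)).card =
      Nat.card (ResidueField R) ^ n := by
  rw [← h.card_transversal (show n ≤ ℓ by omega)]
  symm
  refine Finset.card_bij
    (fun t _ => Function.surjInv residue_surjective (-residue R e) + ϖ * t) ?_ ?_ ?_
  · intro t ht
    refine Finset.mem_filter.2 ⟨mem_transversal_succ.2 ⟨_, t, ht, rfl⟩, ?_⟩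
    rw [← residue_ne_zero_iff_isUnit, not_not, map_add, h.residue_surjInv_add, add_neg_cancel]
  · intro t ht t' ht' he
    exact h.eq_of_mem_transversal (by omega) ht ht'
      (h.surjInv_add_inj hn (sub_eq_zero.2 he ▸ dvd_zero _)).2
  · intro r hr
    obtain ⟨hr, hu⟩ := Finset.mem_filter.1 hr
    obtain ⟨c, t, ht, rfl⟩ := mem_transversal_succ.1 hr
    refine ⟨t, ht, ?_⟩
    rw [← residue_ne_zero_iff_isUnit, not_not, map_add, h.residue_surjInv_add] at hu
    rw [eq_neg_of_add_eq_zero_right hu]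

open Classical in
theorem card_filter_isUnit_add (h : IsUniserialOfLength R ϖ ℓ) {n : ℕ} (hn : n + 1 ≤ ℓ)
    (e : R) : (((transversal ϖ (n + 1)).filter fun r => IsUnit (e + r)).card : ℚ) =
      (Nat.card (ResidueField R) : ℚ) ^ (n + 1) - (Nat.card (ResidueField R) : ℚ) ^ n := by
  have := Finset.card_filter_add_card_filter_not (s := transversal ϖ (n + 1))
    (fun r => IsUnit (e + r))
  rw [h.card_filter_not_isUnit_add hn, h.card_transversal hn] at this
  rw [eq_sub_iff_add_eq]
  exact_mod_cast this

end IsUniserialOfLength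

end Transversal

/-! ### Conjugacy and normal forms relative to a basis. -/

section Conj

variable {R : Type*} [CommRing R]

/-- The matrices `K` from which the normal forms `d + ϖ ^ j K` are built. -/
def kernelMatrix (ϖ : R) (k : ℕ) (x y p z : R) : Matrix (Fin 3) (Fin 3) R :=
  !![0, ϖ ^ k * x, ϖ ^ k * p; 1, y, 0; 0, ϖ ^ k * z, 0]

theorem isConj_of_mul_eq_mul {n : Type*} [Fintype n] [DecidableEq n] {M N P : Matrix n n R}
    (hP : IsUnit P.det) (h : M * P = P * N) : IsConj M N := by
  obtain ⟨U, rfl⟩ := (Matrix.isUnit_iff_isUnit_det P).2 hP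
  exact IsConj.symm ⟨U, h.symm⟩

theorem IsConj.smul_one_add_smul {n : Type*} [Fintype n] [DecidableEq n] {M N : Matrix n n R}
    (h : IsConj M N) (d e : R) :
    IsConj (d • (1 : Matrix n n R) + e • M) (d • (1 : Matrix n n R) + e • N) := by
  obtain ⟨U, hU⟩ := h
  refine ⟨U, ?_⟩
  rw [SemiconjBy] at hU ⊢
  rw [mul_add, add_mul, mul_smul_comm, mul_smul_comm, smul_mul_assoc, smul_mul_assoc, hU, mul_one,
    one_mul]

theorem IsConj.smul_one_add {n : Type*} [Fintype n] [DecidableEq n] {M N : Matrix n n R}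
    (h : IsConj M N) (d : R) :
    IsConj (d • (1 : Matrix n n R) + M) (d • (1 : Matrix n n R) + N) := by
  simpa using h.smul_one_add_smul d 1

theorem IsConj.matrix_transpose {n : Type*} [Fintype n] [DecidableEq n] {M N : Matrix n n R}
    (h : IsConj M N) : IsConj Mᵀ Nᵀ := by
  obtain ⟨U, hU⟩ := h
  refine isConj_of_mul_eq_mul (P := (U : Matrix n n R)ᵀ) ?_ ?_
  · rw [Matrix.det_transpose]
    exact (Matrix.isUnit_iff_isUnit_det _).1 U.isUnit
  · rw [← Matrix.transpose_mul, ← Matrix.transpose_mul, hU.eq]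

/-- The matrix with columns `u`, `v`, `w`. -/
def colMatrix (u v w : Fin 3 → R) : Matrix (Fin 3) (Fin 3) R :=
  (Matrix.of ![u, v, w])ᵀ

theorem mul_colMatrix (N : Matrix (Fin 3) (Fin 3) R) (u v w : Fin 3 → R) :
    N * colMatrix u v w = colMatrix (N *ᵥ u) (N *ᵥ v) (N *ᵥ w) := by
  ext i j
  fin_cases j <;> rfl

theorem exists_eq_of_isUnit_det_colMatrix {u v w : Fin 3 → R}
    (h : IsUnit (colMatrix u v w).det) (t : Fin 3 → R) :
    ∃ a b c : R, t = a • u + b • v + c • w := by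
  have h1 : t = (colMatrix u v w) *ᵥ ((colMatrix u v w)⁻¹ *ᵥ t) := by
    rw [Matrix.mulVec_mulVec, Matrix.mul_nonsing_inv _ h, Matrix.one_mulVec]
  set s := (colMatrix u v w)⁻¹ *ᵥ t
  refine ⟨s 0, s 1, s 2, ?_⟩
  rw [h1]
  ext i
  simp [Matrix.mulVec, dotProduct, Fin.sum_univ_three, colMatrix, mul_comm]

/-- A vector `w` which `N` sends to a multiple of `v` and such that `v`, `N v`, `w` form a basis
gives a normal form for `N`. -/
theorem exists_isConj_of_basis {N : Matrix (Fin 3) (Fin 3) R} {v w : Fin 3 → R} {p : R}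
    (hw : N *ᵥ w = p • v) (hu : IsUnit (colMatrix v (N *ᵥ v) w).det) :
    ∃ x y z : R, IsConj N !![0, x, p; 1, y, 0; 0, z, 0] := by
  obtain ⟨x, y, z, h⟩ := exists_eq_of_isUnit_det_colMatrix hu (N *ᵥ (N *ᵥ v))
  refine ⟨x, y, z, isConj_of_mul_eq_mul hu ?_⟩
  rw [mul_colMatrix, h, hw]
  ext i j
  fin_cases j <;>
    simp [colMatrix, Matrix.mul_apply, Fin.sum_univ_three, mul_comm]

theorem det_colMatrix (u v w : Fin 3 → R) : (colMatrix u v w).det =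
    u 0 * v 1 * w 2 - u 0 * w 1 * v 2 - v 0 * u 1 * w 2 + v 0 * w 1 * u 2 + w 0 * u 1 * v 2
      - w 0 * v 1 * u 2 := by
  simp [colMatrix, Matrix.det_fin_three]
  ring

/-- If `v`, `N v`, `w` form a basis, then `N` is conjugate to a matrix of the shape `r + K`. -/
theorem exists_isConj_smul_one_add {N : Matrix (Fin 3) (Fin 3) R} {v w : Fin 3 → R}
    (hu : IsUnit (colMatrix v (N *ᵥ v) w).det) :
    ∃ r x y p z : R, IsConj N (r • (1 : Matrix (Fin 3) (Fin 3) R) +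
      !![0, x, p; 1, y, 0; 0, z, 0]) := by
  obtain ⟨p, s, r, h⟩ := exists_eq_of_isUnit_det_colMatrix hu (N *ᵥ w)
  have hv : (N - r • (1 : Matrix (Fin 3) (Fin 3) R)) *ᵥ v = N *ᵥ v - r • v := by
    rw [Matrix.sub_mulVec, Matrix.smul_mulVec, Matrix.one_mulVec]
  -- Subtracting `r` from `N` and `s • v` from `w` removes the `w` and `N v` components: `(N - r) (w
  -- - s v) = (p + r s) v`.
  obtain ⟨x, y, z, hc⟩ := exists_isConj_of_basis
    (N := N - r • (1 : Matrix (Fin 3) (Fin 3) R)) (v := v) (w := w - s • v) (p := p + r * s)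
    (by
      rw [Matrix.mulVec_sub, Matrix.mulVec_smul, hv, Matrix.sub_mulVec, Matrix.smul_mulVec,
        Matrix.one_mulVec, h]
      module)
    (by
      rw [hv]
      convert hu using 1
      simp only [det_colMatrix, Pi.sub_apply, Pi.smul_apply, smul_eq_mul]
      ring)
  refine ⟨r, x, y, p + r * s, z, ?_⟩
  have := hc.smul_one_add r
  rwa [add_sub_cancel] at this

/-- The `2 × 2` minors of a conjugate of the product of a column and a row vanish. -/
theorem minor_eq_zero_of_mul_eq_vecMulVec {n : Type*} [Fintype n] [DecidableEq n]
    {M X : Matrix n n R} {c r : n → R} (hX : IsUnit X.det)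
    (h : X * M = Matrix.vecMulVec c r * X) (i i' j j' : n) :
    M i j * M i' j' - M i j' * M i' j = 0 := by
  have hM : M = Matrix.vecMulVec (X⁻¹ *ᵥ c) (r ᵥ* X) := by
    rw [← Matrix.mul_vecMulVec, ← Matrix.vecMulVec_mul, ← h, ← mul_assoc,
      Matrix.nonsing_inv_mul _ hX, one_mul]
  rw [hM]
  simp only [Matrix.vecMulVec_apply]
  ring

/-- The entry `1` in position `(1, 0)` turns vanishing minors into vanishing entries. This is how
rank one modulo `ϖ ^ k` is detected. -/
theorem eq_zero_of_mul_eq_vecMulVec {X : Matrix (Fin 3) (Fin 3) R} {c r : Fin 3 → R}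
    {e x y p z : R} (hX : IsUnit X.det)
    (h : X * (e • (1 : Matrix (Fin 3) (Fin 3) R) + !![0, x, p; 1, y, 0; 0, z, 0]) =
      Matrix.vecMulVec c r * X) : e = 0 ∧ x = 0 ∧ p = 0 ∧ z = 0 := by
  have hm := minor_eq_zero_of_mul_eq_vecMulVec hX h
  have he : e = 0 := by simpa using hm 1 2 0 2
  subst he
  exact ⟨rfl, by simpa using hm 0 1 0 1, by simpa using hm 0 1 0 2, by simpa using hm 1 2 0 1⟩

end Conj

/-! ### Normalising `p` or `z` to `1`. -/

section Existence

variable {R : Type*} [CommRing R]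

/-- Replacing `v` by `v - e w` adapts the basis to `N - ϖ ^ k e`. This matrix is still a column
times a row modulo `ϖ ^ k`, which forces the new `x` and `z` entries to be divisible by `ϖ ^ k`. The
freedom in `e` later reduces the scalar `d` modulo `ϖ ^ (j + k)`. -/
theorem exists_isConj_kernelMatrix {N : Matrix (Fin 3) (Fin 3) R} {v w c r : Fin 3 → R} {ϖ : R}
    {k : ℕ} (hN : ∀ i j, ϖ ^ k ∣ N i j - c i * r j) (hw : N *ᵥ w = ϖ ^ k • v)
    (hu : IsUnit (colMatrix v (N *ᵥ v) w).det) (e : R) :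
    ∃ x y z : R, IsConj N ((ϖ ^ k * e) • (1 : Matrix (Fin 3) (Fin 3) R) +
      kernelMatrix ϖ k x y 1 z) := by
  set N' := N - (ϖ ^ k * e) • (1 : Matrix (Fin 3) (Fin 3) R) with hN'
  have hN'v : ∀ t, N' *ᵥ t = N *ᵥ t - (ϖ ^ k * e) • t := fun t => by
    rw [hN', Matrix.sub_mulVec, Matrix.smul_mulVec, Matrix.one_mulVec]
  obtain ⟨x, y, z, hc⟩ := exists_isConj_of_basis (N := N') (v := v - e • w) (w := w) (p := ϖ ^ k)
    (by rw [hN'v, hw]; module)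
    (by
      rw [hN'v, Matrix.mulVec_sub, Matrix.mulVec_smul, hw]
      convert hu using 1
      simp only [det_colMatrix, Pi.sub_apply, Pi.smul_apply, smul_eq_mul]
      ring)
  obtain ⟨U, hU⟩ := hc.symm
  let f := Ideal.Quotient.mk (Ideal.span {ϖ ^ k})
  have hf : ∀ s, f s = 0 ↔ ϖ ^ k ∣ s := fun s => by
    rw [Ideal.Quotient.eq_zero_iff_mem, Ideal.mem_span_singleton]
  have hUf : IsUnit ((U : Matrix (Fin 3) (Fin 3) R).map f).det := by
    have := (((Matrix.isUnit_iff_isUnit_det _).1 U.isUnit).map f)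
    rwa [RingHom.map_det] at this
  have key := eq_zero_of_mul_eq_vecMulVec (e := 0) (x := f x) (y := f y) (p := f (ϖ ^ k))
    (z := f z) (c := f ∘ c) (r := f ∘ r) hUf (by
      have h1 := congrArg (fun M : Matrix (Fin 3) (Fin 3) R => M.map f) hU.eq
      simp only [Matrix.map_mul] at h1
      convert h1 using 2
      · ext i j
        fin_cases i <;> fin_cases j <;> simp
      · ext i j
        have h0 : f ((ϖ ^ k * e) * (1 : Matrix (Fin 3) (Fin 3) R) i j) = 0 :=
          (hf _).2 ((Dvd.intro _ rfl).mul_right _)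
        have h2 : f (N i j) = f (c i * r j) := by
          rw [← sub_eq_zero, ← map_sub, hf]
          exact hN i j
        simp only [hN', Matrix.map_apply, Matrix.sub_apply, Matrix.smul_apply, smul_eq_mul, map_sub,
          h0, h2, Matrix.vecMulVec_apply, Function.comp_apply, map_mul, sub_zero])
  obtain ⟨x', rfl⟩ := (hf x).1 key.2.1
  obtain ⟨z', rfl⟩ := (hf z).1 key.2.2.2
  refine ⟨x', y, z', ?_⟩
  have := hc.smul_one_add (ϖ ^ k * e)
  rw [hN', add_sub_cancel] at this
  simpa [kernelMatrix] using this

theorem kernelMatrix_dvd_sub (ϖ : R) (k : ℕ) (x y p z : R) (i j : Fin 3) :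
    ϖ ^ k ∣ kernelMatrix ϖ k x y p z i j - ![0, 1, 0] i * ![1, y, 0] j := by
  fin_cases i <;> fin_cases j <;> simp [kernelMatrix]

/-- Transposition exchanges the two shapes, so arguments about `p` also apply to `z`. -/
theorem isConj_transpose_kernelMatrix (ϖ : R) (k : ℕ) (x y p z : R) :
    IsConj (kernelMatrix ϖ k x y p z)ᵀ (kernelMatrix ϖ k x y z p) := by
  refine isConj_of_mul_eq_mul (P := colMatrix ![0, 1, 0] ![1, y, 0] ![0, 0, 1]) ?_ ?_
  · rw [det_colMatrix]; simp
  · ext i j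
    fin_cases i <;> fin_cases j <;>
      simp [kernelMatrix, colMatrix, Matrix.mul_apply, Fin.sum_univ_three]

variable [IsLocalRing R] {ϖ : R}

theorem IsLocalRing.isUnit_of_residue_eq {a b : R} (hb : IsUnit b)
    (h : residue R a = residue R b) : IsUnit a := by
  rw [← residue_ne_zero_iff_isUnit] at hb ⊢
  rwa [h]

/-- Sufficient condition for a `K` to be conjugate to one with `p = 1`. -/
theorem exists_basis_kernelMatrix (h : residue R ϖ = 0) {k : ℕ} {x y p z : R}
    (hu : IsUnit p ∨ IsUnit x ∨ IsUnit z ∧ (k = 0 ∨ IsUnit y)) :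
    ∃ v w : Fin 3 → R, kernelMatrix ϖ k x y p z *ᵥ w = ϖ ^ k • v ∧
      IsUnit (colMatrix v (kernelMatrix ϖ k x y p z *ᵥ v) w).det := by
  by_cases hp : IsUnit p
  · refine ⟨![p, 0, 0], ![0, 0, 1], ?_, ?_⟩
    · ext i; fin_cases i <;> simp [kernelMatrix]
    · convert hp.mul hp using 1
      simp [det_colMatrix, kernelMatrix]
  have hp0 : residue R p = 0 := by rwa [← residue_ne_zero_iff_isUnit, not_not] at hp
  -- For `k = 0` the condition reads `v = K w`, so what is sought is a cyclic vector `w`.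
  rcases Nat.eq_zero_or_pos k with rfl | hk
  · by_cases hz : IsUnit z
    · refine ⟨![0, 1, 0], ![1, 0, 0], ?_, ?_⟩
      · ext i; fin_cases i <;> simp [kernelMatrix]
      · convert hz using 1
        simp [det_colMatrix, kernelMatrix]
    · have hx : IsUnit x := by tauto
      have hz0 : residue R z = 0 := by rwa [← residue_ne_zero_iff_isUnit, not_not] at hz
      refine ⟨![p, 1, 0], ![1, 0, 1], ?_, ?_⟩
      · ext i; fin_cases i <;> simp [kernelMatrix]
      · refine isUnit_of_residue_eq hx.neg ?_
        simp [det_colMatrix, kernelMatrix, hp0, hz0]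
  have hk' : (residue R ϖ) ^ k = 0 := by rw [h, zero_pow hk.ne']
  -- For `k > 0`, the vector `K w` must vanish modulo `ϖ ^ k`, that is, `w 0` is congruent to `-y *
  -- w 1`. In this case the determinant is `(x + b y) y z` modulo `ϖ`, which dictates the choice of
  -- `b`.
  by_cases hyz : IsUnit (y * z)
  · have hb : ∃ b : R, IsUnit (x + b * y) := by
      by_cases hx : IsUnit x
      · exact ⟨0, by simpa using hx⟩
      · refine ⟨1, isUnit_of_residue_eq (isUnit_of_mul_isUnit_left hyz) ?_⟩
        rw [← residue_ne_zero_iff_isUnit, not_not] at hx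
        simp [hx]
    obtain ⟨b, hb⟩ := hb
    refine ⟨![x, b, z], ![ϖ ^ k * b - y, 1, 0], ?_, ?_⟩
    · ext i
      fin_cases i <;> simp [kernelMatrix]
    · refine isUnit_of_residue_eq (hb.mul hyz) ?_
      simp [det_colMatrix, kernelMatrix, hp0, hk']
      ring
  · rw [IsUnit.mul_iff] at hyz
    have hx : IsUnit x := by
      rcases hu with h1 | h1 | h1
      · exact absurd h1 hp
      · exact h1
      · rcases h1.2 with h2 | h2
        · omega
        · exact absurd ⟨h2, h1.1⟩ hyz
    -- Modulo `ϖ` the determinant is `x (x + y z)`, and `y z` is not a unit.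
    refine ⟨![x + p, 0, z], ![-y, 1, 1], ?_, ?_⟩
    · ext i
      fin_cases i <;> simp [kernelMatrix]
      ring
    · refine isUnit_of_residue_eq (hx.mul hx) (sub_eq_zero.1 ?_)
      simp [det_colMatrix, kernelMatrix, hp0, hk']
      tauto

/-- Every `K` with a unit among `x`, `p`, `z` can be brought, after a shift by any scalar in
`(ϖ ^ k)`, to the shape with `p = 1`, or to the shape with `z = 1` and all other parameters
non-units. -/
theorem exists_isConj_of_isUnit (h : residue R ϖ = 0) {k : ℕ} {x y p z : R}
    (hu : IsUnit x ∨ IsUnit p ∨ IsUnit z) (e : R) :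
    (∃ x' y' z' : R, IsConj (kernelMatrix ϖ k x y p z)
      ((ϖ ^ k * e) • (1 : Matrix (Fin 3) (Fin 3) R) + kernelMatrix ϖ k x' y' 1 z')) ∨ 0 < k ∧
    (∃ x' y' z' : R, ¬ IsUnit x' ∧ ¬ IsUnit y' ∧ ¬ IsUnit z' ∧
      IsConj (kernelMatrix ϖ k x y p z) ((ϖ ^ k * e) • (1 : Matrix (Fin 3) (Fin 3) R) +
        kernelMatrix ϖ k x' y' z' 1)) := by
  have hA : ∀ {x y p z : R}, (IsUnit p ∨ IsUnit x ∨ IsUnit z ∧ (k = 0 ∨ IsUnit y)) → ∀ e : R,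
      ∃ x' y' z' : R, IsConj (kernelMatrix ϖ k x y p z)
        ((ϖ ^ k * e) • (1 : Matrix (Fin 3) (Fin 3) R) + kernelMatrix ϖ k x' y' 1 z') := by
    intro x y p z hu e
    obtain ⟨v, w, hw, hd⟩ := exists_basis_kernelMatrix h hu
    exact exists_isConj_kernelMatrix (kernelMatrix_dvd_sub ϖ k x y p z) hw hd e
  by_cases hc : IsUnit p ∨ IsUnit x ∨ IsUnit z ∧ (k = 0 ∨ IsUnit y)
  · exact Or.inl (hA hc e)
  have hk : 0 < k := by
    by_contra h0
    have : k = 0 := by omega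
    tauto
  have hz : IsUnit z := by tauto
  -- Only `z` is a unit here, so the transpose is normalised instead: it sends the last basis vector
  -- to `ϖ ^ k z` times the middle one.
  obtain ⟨x', y', z', hc'⟩ := exists_isConj_kernelMatrix (N := (kernelMatrix ϖ k x y p z)ᵀ)
    (v := ![0, z, 0]) (w := ![0, 0, 1]) (c := ![1, y, 0]) (r := ![0, 1, 0]) (ϖ := ϖ) (k := k)
    (fun i j => by
      rw [Matrix.transpose_apply, mul_comm]
      exact kernelMatrix_dvd_sub ϖ k x y p z j i)
    (by ext i; fin_cases i <;> simp [kernelMatrix, Matrix.mulVec, dotProduct, Fin.sum_univ_three])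
    (by
      refine isUnit_of_residue_eq (hz.mul hz).neg ?_
      simp [det_colMatrix, kernelMatrix, Matrix.mulVec, dotProduct, Fin.sum_univ_three]) e
  have hB : IsConj (kernelMatrix ϖ k x y p z)
      ((ϖ ^ k * e) • (1 : Matrix (Fin 3) (Fin 3) R) + kernelMatrix ϖ k x' y' z' 1) := by
    have h1 := hc'.matrix_transpose
    rw [Matrix.transpose_transpose, Matrix.transpose_add, Matrix.transpose_smul,
      Matrix.transpose_one] at h1
    exact h1.trans ((isConj_transpose_kernelMatrix ϖ k x' y' 1 z').smul_one_add _)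
  -- The second shape is kept only if it cannot be brought to the first.
  by_cases hn : IsUnit z' ∨ IsUnit x' ∨ IsUnit (1 : R) ∧ (k = 0 ∨ IsUnit y')
  · obtain ⟨x₁, y₁, z₁, h1⟩ := hA hn 0
    refine Or.inl ⟨x₁, y₁, z₁, hB.trans ?_⟩
    have h2 := h1.smul_one_add (ϖ ^ k * e)
    simpa using h2
  · refine Or.inr ⟨hk, x', y', z', ?_, ?_, ?_, hB⟩
    · tauto
    · intro hy; exact hn (Or.inr (Or.inr ⟨isUnit_one, Or.inr hy⟩))
    · tauto

end Existence

/-- The matrix `d + ϖ ^ j K`, where `K` is the matrix `kernelMatrix ϖ k x y p z`. -/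
def normalForm {R : Type*} [CommRing R] (ϖ : R) (j k : ℕ) (d x y p z : R) :
    Matrix (Fin 3) (Fin 3) R :=
  d • (1 : Matrix (Fin 3) (Fin 3) R) + ϖ ^ j • kernelMatrix ϖ k x y p z

/-- Over the residue field, a matrix having every vector as an eigenvector is scalar. The basis
vectors kill the off-diagonal entries, and two sums of basis vectors equate the diagonal ones. -/
theorem exists_isUnit_det_colMatrix_or_scalar {R : Type*} [CommRing R] [IsLocalRing R]
    (N : Matrix (Fin 3) (Fin 3) R) :
    (∃ v w : Fin 3 → R, IsUnit (colMatrix v (N *ᵥ v) w).det) ∨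
      ∃ c : R, ∀ i j, ¬ IsUnit ((N - c • (1 : Matrix (Fin 3) (Fin 3) R)) i j) := by
  by_contra! hcon
  obtain ⟨h1, h2⟩ := hcon
  have h1' : ∀ v w : Fin 3 → R, residue R (colMatrix v (N *ᵥ v) w).det = 0 := fun v w => by
    have := h1 v w
    rwa [← residue_ne_zero_iff_isUnit, not_not] at this
  obtain ⟨i, j, hij⟩ := h2 (N 0 0)
  rw [← residue_ne_zero_iff_isUnit] at hij
  refine hij ?_
  have a01 := h1' ![0, 1, 0] ![0, 0, 1]
  have a02 := h1' ![0, 0, 1] ![0, 1, 0]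
  have a10 := h1' ![1, 0, 0] ![0, 0, 1]
  have a12 := h1' ![0, 0, 1] ![1, 0, 0]
  have a20 := h1' ![1, 0, 0] ![0, 1, 0]
  have a21 := h1' ![0, 1, 0] ![1, 0, 0]
  have b1 := h1' ![1, 1, 0] ![0, 0, 1]
  have b2 := h1' ![1, 0, 1] ![0, 1, 0]
  simp only [det_colMatrix, Matrix.mulVec, dotProduct, Fin.sum_univ_three, Matrix.cons_val_zero,
    Matrix.cons_val_one, Matrix.cons_val, mul_zero, zero_mul, mul_one, one_mul, add_zero, zero_add,
    sub_zero, zero_sub, map_neg, map_sub, map_add, neg_eq_zero]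
    at a01 a02 a10 a12 a20 a21 b1 b2
  fin_cases i <;> fin_cases j <;>
    simp [a01, a02, a10, a12, a20, a21]
  · linear_combination b1 - a10 + a01
  · linear_combination - b2 - a20 + a02

/-! ### Existence of normal forms. -/

namespace IsUniserialOfLength

variable {R : Type*} [CommRing R] [IsLocalRing R] {ϖ : R} {ℓ : ℕ}

theorem pow_mul_pow_mul_eq (h : IsUniserialOfLength R ϖ ℓ) {m n a : ℕ} (hl : m + n + a = ℓ)
    {x x' : R} (hx : ϖ ^ a ∣ x - x') : ϖ ^ m * (ϖ ^ n * x) = ϖ ^ m * (ϖ ^ n * x') := by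
  rw [← sub_eq_zero, ← mul_sub, ← mul_sub, ← mul_assoc, ← pow_add, h.pow_mul_eq_zero_iff hl]
  exact hx

/-- The parameters `x, p, z` enter with the factor `ϖ ^ (j + k)` but `y` only with `ϖ ^ j`, whence
the different precisions. -/
theorem normalForm_congr (h : IsUniserialOfLength R ϖ ℓ) {j k a : ℕ} (hl : j + k + a = ℓ)
    (d : R) {x x' y y' p p' z z' : R} (hx : ϖ ^ a ∣ x - x') (hy : ϖ ^ (k + a) ∣ y - y')
    (hp : ϖ ^ a ∣ p - p') (hz : ϖ ^ a ∣ z - z') :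
    normalForm ϖ j k d x y p z = normalForm ϖ j k d x' y' p' z' := by
  have hy' : ϖ ^ j * y = ϖ ^ j * y' := by
    simpa using h.pow_mul_pow_mul_eq (m := j) (n := 0) (a := k + a) (by omega) hy
  rw [normalForm, normalForm]
  congr 1
  ext i i'
  fin_cases i <;> fin_cases i' <;>
    simp [kernelMatrix, hy', h.pow_mul_pow_mul_eq hl hx, h.pow_mul_pow_mul_eq hl hp,
      h.pow_mul_pow_mul_eq hl hz]

theorem exists_isConj_normalForm_of_isUnit (h : IsUniserialOfLength R ϖ ℓ) {j k a : ℕ}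
    [Finite (ResidueField R)] (hl : j + k + a = ℓ) (ha : 0 < a) {r x y p z : R}
    (hu : IsUnit x ∨ IsUnit p ∨ IsUnit z) :
    ∃ d ∈ transversal ϖ (j + k), ∃ x' ∈ transversal ϖ a, ∃ y' ∈ transversal ϖ (k + a),
      ∃ z' ∈ transversal ϖ a, IsConj (normalForm ϖ j k r x y p z) (normalForm ϖ j k d x' y' 1 z') ∨
        0 < k ∧ ¬ IsUnit x' ∧ ¬ IsUnit y' ∧ ¬ IsUnit z' ∧
          IsConj (normalForm ϖ j k r x y p z) (normalForm ϖ j k d x' y' z' 1) := by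
  obtain ⟨d, hd, c, hc⟩ := h.exists_transversal (j + k) r
  refine ⟨d, hd, ?_⟩
  -- With `r = d + ϖ ^ (j + k) c`, a shift of `K` by `-ϖ ^ k c` reduces the scalar from `r` to its
  -- representative `d`.
  have hshift : ∀ M : Matrix (Fin 3) (Fin 3) R, r • (1 : Matrix (Fin 3) (Fin 3) R) +
      ϖ ^ j • ((ϖ ^ k * -c) • (1 : Matrix (Fin 3) (Fin 3) R) + M) =
      d • (1 : Matrix (Fin 3) (Fin 3) R) + ϖ ^ j • M := fun M => by
    rw [smul_add, smul_smul, ← add_assoc, ← add_smul]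
    congr 2
    rw [pow_add] at hc
    linear_combination hc
  have hnu : ∀ {n : ℕ} {s t : R}, 0 < n → ϖ ^ n ∣ s - t → ¬ IsUnit s → ¬ IsUnit t := by
    intro n s t hn hd hs
    rw [h.not_isUnit_iff] at hs ⊢
    have := (dvd_pow_self ϖ hn.ne').trans hd
    exact (dvd_sub_right hs).1 this
  rcases exists_isConj_of_isUnit h.residue_eq_zero (k := k) (y := y) hu (-c) with
    ⟨x₁, y₁, z₁, hc₁⟩ | ⟨hk, x₁, y₁, z₁, hx₁, hy₁, hz₁, hc₁⟩ <;>
  obtain ⟨x', hx', hxd⟩ := h.exists_transversal a x₁ <;>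
  obtain ⟨y', hy', hyd⟩ := h.exists_transversal (k + a) y₁ <;>
  obtain ⟨z', hz', hzd⟩ := h.exists_transversal a z₁ <;>
  refine ⟨x', hx', y', hy', z', hz', ?_⟩ <;>
  have hc₂ := hc₁.smul_one_add_smul r (ϖ ^ j) <;>
  rw [hshift] at hc₂
  · left
    rw [← h.normalForm_congr hl d hxd hyd (sub_self (1 : R) ▸ dvd_zero _) hzd]
    exact hc₂
  · right
    refine ⟨hk, hnu ha hxd hx₁, hnu (by omega) hyd hy₁, hnu ha hzd hz₁, ?_⟩
    rw [← h.normalForm_congr hl d hxd hyd hzd (sub_self (1 : R) ▸ dvd_zero _)]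
    exact hc₂

theorem exists_isConj_normalForm (h : IsUniserialOfLength R ϖ ℓ) [Finite (ResidueField R)]
    (α : Matrix (Fin 3) (Fin 3) R) :
    ∃ j k a, j + k + a = ℓ ∧
    ∃ d ∈ transversal ϖ (j + k), ∃ x ∈ transversal ϖ a, ∃ y ∈ transversal ϖ (k + a),
      ∃ z ∈ transversal ϖ a, IsConj α (normalForm ϖ j k d x y 1 z) ∨
        0 < k ∧ 0 < a ∧ ¬ IsUnit x ∧ ¬ IsUnit y ∧ ¬ IsUnit z ∧
          IsConj α (normalForm ϖ j k d x y z 1) := by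
  classical
  -- As `ϖ ^ ℓ = 0`, the representatives modulo `ϖ ^ ℓ` are all of `R`.
  have hD : ∀ r, r ∈ transversal ϖ ℓ := fun r => by
    obtain ⟨t, ht, c, hc⟩ := h.exists_transversal ℓ r
    rw [h.pow_eq_zero, zero_mul, sub_eq_zero] at hc
    rwa [hc]
  let P : ℕ → Prop := fun j => ∃ (d : R) (β : Matrix (Fin 3) (Fin 3) R),
    α = d • (1 : Matrix (Fin 3) (Fin 3) R) + ϖ ^ j • β
  obtain ⟨d, β, hβ⟩ : P (Nat.findGreatest P ℓ) :=
    Nat.findGreatest_spec (m := 0) (Nat.zero_le ℓ) ⟨0, α, by simp⟩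
  have hmax : ∀ n, Nat.findGreatest P ℓ < n → n ≤ ℓ → ¬ P n :=
    fun n h1 h2 => Nat.findGreatest_is_greatest h1 h2
  have hjl := Nat.findGreatest_le (P := P) ℓ
  generalize Nat.findGreatest P ℓ = j at hβ hmax hjl
  rcases hjl.eq_or_lt with rfl | hjl
  · refine ⟨j, 0, 0, rfl, d, hD d, 0, mem_transversal_zero.2 rfl, 0, mem_transversal_zero.2 rfl, 0,
      mem_transversal_zero.2 rfl, Or.inl ?_⟩
    rw [hβ, normalForm, h.pow_eq_zero, zero_smul, zero_smul]
  rcases exists_isUnit_det_colMatrix_or_scalar β with ⟨v, w, hu⟩ | ⟨c, hc⟩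
  swap
  -- A scalar residue could be absorbed in `d`, contradicting the maximality of `j`.
  · exfalso
    refine hmax (j + 1) (by omega) (by omega) ?_
    choose γ hγ using fun i i' => h.not_isUnit_iff.1 (hc i i')
    refine ⟨d + ϖ ^ j * c, Matrix.of γ, ?_⟩
    have : β = c • (1 : Matrix (Fin 3) (Fin 3) R) + ϖ • Matrix.of γ := by
      rw [← sub_eq_iff_eq_add']
      ext i i'
      exact hγ i i'
    rw [hβ, this, smul_add, smul_smul, smul_smul, add_smul, add_assoc, pow_succ]
  obtain ⟨r, x, y, p, z, hconj⟩ := exists_isConj_smul_one_add hu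
  replace hconj := hconj.smul_one_add_smul d (ϖ ^ j)
  rw [← hβ, smul_add, smul_smul, ← add_assoc, ← add_smul] at hconj
  set d' := d + ϖ ^ j * r
  let Q : ℕ → Prop := fun k => ϖ ^ k ∣ x ∧ ϖ ^ k ∣ p ∧ ϖ ^ k ∣ z
  obtain ⟨k, hkl, ⟨⟨x₁, hx⟩, ⟨p₁, hp⟩, ⟨z₁, hz⟩⟩, hmaxk⟩ :
      ∃ k ≤ ℓ - j, Q k ∧ ∀ n, k < n → n ≤ ℓ - j → ¬ Q n :=
    ⟨Nat.findGreatest Q (ℓ - j), Nat.findGreatest_le _,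
      Nat.findGreatest_spec (m := 0) (Nat.zero_le _) (by simp [Q]),
      fun n h1 h2 => Nat.findGreatest_is_greatest h1 h2⟩
  have hconj' : IsConj α (normalForm ϖ j k d' x₁ y p₁ z₁) := by
    rwa [normalForm, kernelMatrix, ← hx, ← hp, ← hz]
  have hl : j + k + (ℓ - j - k) = ℓ := by omega
  rcases hkl.eq_or_lt with hkl | hkl
  -- Here `ϖ ^ (j + k) = 0`, so `x, p, z` have no effect; taking `p = 1` is a convention that places
  -- this case in the first shape.
  · obtain ⟨y', hy', hyd⟩ := h.exists_transversal k y
    refine ⟨j, k, 0, by omega, d', by rw [show j + k = ℓ by omega]; exact hD _, 0,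
      mem_transversal_zero.2 rfl, y', hy', 0, mem_transversal_zero.2 rfl, Or.inl ?_⟩
    rwa [h.normalForm_congr (a := 0) (by omega) d' (x' := 0) (p' := 1) (z' := 0) (by simp) hyd
      (by simp) (by simp)] at hconj'
  · have hu' : IsUnit x₁ ∨ IsUnit p₁ ∨ IsUnit z₁ := by
      by_contra hcon
      rw [not_or, not_or, h.not_isUnit_iff, h.not_isUnit_iff, h.not_isUnit_iff] at hcon
      refine hmaxk (k + 1) (by omega) (by omega) ?_
      refine ⟨?_, ?_, ?_⟩
      · rw [hx, pow_succ]; exact mul_dvd_mul_left _ hcon.1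
      · rw [hp, pow_succ]; exact mul_dvd_mul_left _ hcon.2.1
      · rw [hz, pow_succ]; exact mul_dvd_mul_left _ hcon.2.2
    obtain ⟨e, he, x', hx', y', hy', z', hz', hc⟩ :=
      h.exists_isConj_normalForm_of_isUnit hl (by omega) (r := d') (y := y) hu'
    refine ⟨j, k, _, hl, e, he, x', hx', y', hy', z', hz', ?_⟩
    rcases hc with hc | ⟨hk, h1, h2, h3, hc⟩
    · exact Or.inl (hconj'.trans hc)
    · exact Or.inr ⟨hk, by omega, h1, h2, h3, hconj'.trans hc⟩

end IsUniserialOfLength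

/-! ### Quantities preserved by conjugation. -/

section Invariants

variable {R S : Type*} [CommRing R] [CommRing S]

theorem isUnit_det_map (f : R →+* S)
    {X : Matrix (Fin 3) (Fin 3) R} (hX : IsUnit X.det) :
    IsUnit (X.map f).det := by
  have := hX.map f
  rwa [RingHom.map_det] at this

theorem kernelMatrix_map (f : R →+* S) (ϖ : R) (k : ℕ) (x y p z : R) :
    (kernelMatrix ϖ k x y p z).map f = kernelMatrix (f ϖ) k (f x) (f y) (f p) (f z) := by
  ext i j
  fin_cases i <;> fin_cases j <;> simp [kernelMatrix]

theorem kernelMatrix_eq_vecMulVec {ϖ : R} {k : ℕ} (h : ϖ ^ k = 0) (x y p z : R) :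
    kernelMatrix ϖ k x y p z = Matrix.vecMulVec ![0, 1, 0] ![1, y, 0] := by
  ext i j
  fin_cases i <;> fin_cases j <;> simp [kernelMatrix, h, Matrix.vecMulVec_apply]

/-- The matrix `ϖ⁻ᵏ (K ^ 2 - y K) - x`, where `K` is the matrix `kernelMatrix ϖ k x y p z`. -/
def dividedMatrix (ϖ : R) (k : ℕ) (x y p z : R) : Matrix (Fin 3) (Fin 3) R :=
  !![0, ϖ ^ k * (z * p), -(y * p); 0, 0, p; z, 0, -x]

theorem kernelMatrix_sq_sub (ϖ : R) (k : ℕ) (x y p z : R) :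
    kernelMatrix ϖ k x y p z * kernelMatrix ϖ k x y p z - y • kernelMatrix ϖ k x y p z -
      (ϖ ^ k * x) • (1 : Matrix (Fin 3) (Fin 3) R) = ϖ ^ k • dividedMatrix ϖ k x y p z := by
  ext i j
  fin_cases i <;> fin_cases j <;>
    simp [kernelMatrix, dividedMatrix] <;> ring

/-- A matrix intertwining `K` and `K'` also intertwines their polynomials `ϖ ^ k D` and `ϖ ^ k D'`.
Dividing by `ϖ ^ k` loses `k` levels of precision, which leaves `a` of them. -/
theorem smul_dividedMatrix_eq {ϖ : R} {j k : ℕ} {x y p z p' z' : R}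
    {X : Matrix (Fin 3) (Fin 3) R} (hc : ϖ ^ j • (X * kernelMatrix ϖ k x y p z) =
    ϖ ^ j • (kernelMatrix ϖ k x y p' z' * X)) :
    ϖ ^ (j + k) • (X * dividedMatrix ϖ k x y p z) =
      ϖ ^ (j + k) • (dividedMatrix ϖ k x y p' z' * X) := by
  rw [pow_add, mul_smul, mul_smul, ← mul_smul_comm (ϖ ^ k), ← smul_mul_assoc (ϖ ^ k),
    ← kernelMatrix_sq_sub,
    ← kernelMatrix_sq_sub]
  simp only [mul_sub, sub_mul, smul_sub, mul_smul_comm, smul_mul_assoc, mul_one, one_mul]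
  rw [smul_comm (ϖ ^ j) y, smul_comm (ϖ ^ j) y, hc, ← mul_assoc, ← smul_mul_assoc, hc,
    smul_mul_assoc, mul_assoc, ← mul_smul_comm, hc, mul_smul_comm, mul_assoc]

theorem dividedMatrix_sq_add (ϖ : R) (k : ℕ) (x y p z : R) :
    dividedMatrix ϖ k x y p z * dividedMatrix ϖ k x y p z + x • dividedMatrix ϖ k x y p z =
      (p * z) • (kernelMatrix ϖ k x y p z - y • (1 : Matrix (Fin 3) (Fin 3) R)) := by
  ext i j
  fin_cases i <;> fin_cases j <;>
    simp [kernelMatrix, dividedMatrix] <;> ring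

theorem dividedMatrix_map (f : R →+* S) (ϖ : R) (k : ℕ) (x y p z : R) :
    (dividedMatrix ϖ k x y p z).map f = dividedMatrix (f ϖ) k (f x) (f y) (f p) (f z) := by
  ext i j
  fin_cases i <;> fin_cases j <;> simp [dividedMatrix]

theorem trace_det_eq_of_mul_eq_mul {ϖ : R} {k k' : ℕ} {x y p z x' y' p' z' : R}
    {X : Matrix (Fin 3) (Fin 3) R} (hX : IsUnit X.det)
    (h : X * kernelMatrix ϖ k x y p z = kernelMatrix ϖ k' x' y' p' z' * X) :
    y = y' ∧ ϖ ^ k * x = ϖ ^ k' * x' := by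
  have h1 : kernelMatrix ϖ k x y p z = X⁻¹ * kernelMatrix ϖ k' x' y' p' z' * X := by
    rw [mul_assoc, ← h, ← mul_assoc, Matrix.nonsing_inv_mul _ hX, one_mul]
  have ht : y = y' := by
    have := congrArg Matrix.trace h1
    rw [mul_assoc, Matrix.trace_mul_comm, mul_assoc, Matrix.mul_nonsing_inv _ hX, mul_one] at this
    simpa [kernelMatrix, Matrix.trace, Fin.sum_univ_three] using this
  have hconj : ∀ N N' : Matrix (Fin 3) (Fin 3) R, X * N = N' * X → N.det = N'.det := by
    intro N N' hN
    have := congrArg Matrix.det hN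
    rw [Matrix.det_mul, Matrix.det_mul, mul_comm] at this
    exact hX.mul_right_cancel this
  have h2 := hconj _ _ h
  -- The value of the characteristic polynomial at `-1` supplies its remaining coefficient, `-ϖ ^ k
  -- x`.
  have h3 := hconj (1 + kernelMatrix ϖ k x y p z) (1 + kernelMatrix ϖ k' x' y' p' z')
    (by rw [mul_add, add_mul, h, mul_one, one_mul])
  simp only [kernelMatrix, Matrix.det_fin_three, Matrix.add_apply, Matrix.of_apply,
    Matrix.cons_val', Matrix.cons_val_zero, Matrix.cons_val_one, Matrix.cons_val,
    Matrix.one_apply_eq, Matrix.one_apply, Fin.reduceEq, if_false] at h2 h3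
  refine ⟨ht, ?_⟩
  linear_combination h2 - h3 + ht

/-- Both `K - y` and `D ^ 2 + x D = p z (K - y)` are intertwined; the entry `1` of `K - y` in
position `(1, 0)` then gives equality of the factors. -/
theorem mul_eq_mul_of_dividedMatrix {ϖ : R} {k : ℕ} {x y p z p' z' : R}
    {X : Matrix (Fin 3) (Fin 3) R} (hX : IsUnit X.det)
    (h : X * kernelMatrix ϖ k x y p z = kernelMatrix ϖ k x y p' z' * X)
    (hd : X * dividedMatrix ϖ k x y p z = dividedMatrix ϖ k x y p' z' * X) :
    p * z = p' * z' := by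
  have h1 : X * (dividedMatrix ϖ k x y p z * dividedMatrix ϖ k x y p z +
      x • dividedMatrix ϖ k x y p z) = (dividedMatrix ϖ k x y p' z' *
        dividedMatrix ϖ k x y p' z' + x • dividedMatrix ϖ k x y p' z') * X := by
    rw [mul_add, add_mul, ← mul_assoc, hd, mul_assoc, hd, mul_assoc, mul_smul_comm, smul_mul_assoc,
      hd]
  have h2 : (kernelMatrix ϖ k x y p' z' - y • (1 : Matrix (Fin 3) (Fin 3) R)) * X =
      X * (kernelMatrix ϖ k x y p z - y • (1 : Matrix (Fin 3) (Fin 3) R)) := by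
    rw [sub_mul, mul_sub, h, smul_mul_assoc, mul_smul_comm, one_mul, mul_one]
  rw [dividedMatrix_sq_add, dividedMatrix_sq_add, mul_smul_comm, smul_mul_assoc, h2] at h1
  have h3 := congrArg (fun M => X⁻¹ * M) h1
  simp only [mul_smul_comm] at h3
  rw [← mul_assoc, Matrix.nonsing_inv_mul _ hX, one_mul] at h3
  simpa [kernelMatrix] using congrFun (congrFun h3 1) 0

/-- Over a ring in which `ϖ` and the parameters vanish, the two shapes are not conjugate. -/
theorem false_of_mul_dividedMatrix_eq_mul [Nontrivial R] {ϖ : R} {k : ℕ} (hϖ : ϖ ^ k = 0)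
    {X : Matrix (Fin 3) (Fin 3) R} (hX : IsUnit X.det)
    (h : X * kernelMatrix ϖ k 0 0 1 0 = kernelMatrix ϖ k 0 0 0 1 * X)
    (hd : X * dividedMatrix ϖ k 0 0 1 0 = dividedMatrix ϖ k 0 0 0 1 * X) : False := by
  have e := fun i j => congrFun (congrFun h i) j
  have e' := fun i j => congrFun (congrFun hd i) j
  simp only [kernelMatrix, dividedMatrix, Matrix.mul_apply, Fin.sum_univ_three, hϖ] at e e'
  -- In the first shape the middle basis vector lies in the images of both `K` and `D`. In the
  -- second shape these images meet only in zero, so the middle column of `X` vanishes.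
  have a0 : X 0 1 = 0 := by simpa using e' 0 2
  have a1 : X 1 1 = 0 := by simpa using e' 1 2
  have a2 : X 2 1 = 0 := by simpa using e 2 0
  rw [Matrix.det_fin_three, a0, a1, a2] at hX
  simp at hX

end Invariants

/-! ### Uniqueness of the parameters. -/

namespace IsUniserialOfLength

variable {R : Type*} [CommRing R] [IsLocalRing R] {ϖ : R} {ℓ : ℕ}
  {X : Matrix (Fin 3) (Fin 3) R} {j k a j' k' a' : ℕ} {d x y p z d' x' y' p' z' : R}

/-- One side is scalar modulo `ϖ ^ j'`, hence so is the other. Its entries `ϖ ^ j` at `(1, 0)` and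
`d` at `(0, 0)` give the two claims. -/
theorem le_and_dvd_of_mul_normalForm_eq (h : IsUniserialOfLength R ϖ ℓ) (hX : IsUnit X.det)
    (hj' : j' ≤ ℓ) (hc : X * normalForm ϖ j k d x y p z = normalForm ϖ j' k' d' x' y' p' z' * X) :
    j' ≤ j ∧ ϖ ^ j' ∣ d - d' := by
  have h1 : normalForm ϖ j k d x y p z = d' • (1 : Matrix (Fin 3) (Fin 3) R) +
      ϖ ^ j' • (X⁻¹ * kernelMatrix ϖ k' x' y' p' z' * X) := by
    rw [← one_mul (normalForm ϖ j k d x y p z), ← Matrix.nonsing_inv_mul _ hX, mul_assoc, hc,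
      normalForm, add_mul, mul_add, smul_mul_assoc, smul_mul_assoc, mul_smul_comm, mul_smul_comm,
      one_mul, mul_assoc]
  rw [normalForm] at h1
  set W := X⁻¹ * kernelMatrix ϖ k' x' y' p' z' * X
  constructor
  · exact h.le_of_pow_dvd_pow hj' ⟨W 1 0, by simpa [kernelMatrix] using congrFun (congrFun h1 1) 0⟩
  · refine ⟨W 0 0, ?_⟩
    have h2 : d = d' + ϖ ^ j' * W 0 0 := by
      simpa [kernelMatrix] using congrFun (congrFun h1 0) 0
    linear_combination h2

/-- Matrices which agree after multiplication by `ϖ ^ m` agree modulo `ϖ ^ n`. -/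
theorem map_eq_map_of_smul_eq (h : IsUniserialOfLength R ϖ ℓ) {m n : ℕ} (hmn : m + n ≤ ℓ)
    {S : Type*} [CommRing S] (f : R →+* S) (hf : f (ϖ ^ n) = 0) {M N : Matrix (Fin 3) (Fin 3) R}
    (hMN : ϖ ^ m • M = ϖ ^ m • N) : M.map f = N.map f := by
  ext i i'
  have h1 : ϖ ^ n ∣ M i i' - N i i' := by
    refine h.dvd_of_pow_mul_dvd hmn ?_
    have : ϖ ^ m * M i i' = ϖ ^ m * N i i' := congrFun (congrFun hMN i) i'
    rw [mul_sub, this, sub_self]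
    exact dvd_zero _
  obtain ⟨c, hc⟩ := h1
  rw [Matrix.map_apply, Matrix.map_apply, ← sub_eq_zero, ← map_sub, hc, map_mul, hf, zero_mul]

/-- Modulo `ϖ ^ k'` the matrix `e + K`, with `d = d' + ϖ ^ j e`, is conjugate to a column times a
row. The vanishing minors kill `e` and `ϖ ^ k`, the latter because `p` or `z` equals `1`. -/
theorem le_and_dvd_of_mul_eq_mul (h : IsUniserialOfLength R ϖ ℓ) (hX : IsUnit X.det)
    (hl : j + k ≤ ℓ) (hl' : j + k' ≤ ℓ) (hpz : p = 1 ∨ z = 1)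
    (hc : X * normalForm ϖ j k d x y p z = normalForm ϖ j k' d' x' y' p' z' * X) :
    k' ≤ k ∧ ϖ ^ (j + k') ∣ d - d' := by
  obtain ⟨e, he⟩ := (h.le_and_dvd_of_mul_normalForm_eq hX (by omega) hc).2
  obtain rfl : d = d' + ϖ ^ j * e := by linear_combination he
  have h1 : ϖ ^ j • (X * (e • (1 : Matrix (Fin 3) (Fin 3) R) + kernelMatrix ϖ k x y p z)) =
      ϖ ^ j • (kernelMatrix ϖ k' x' y' p' z' * X) := by
    simp only [normalForm, add_mul, mul_add, mul_smul_comm, smul_mul_assoc, mul_one, one_mul,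
      add_smul] at hc
    rw [mul_add, mul_smul_comm, mul_one, smul_add, smul_smul]
    rw [add_assoc] at hc
    exact add_left_cancel hc
  let f := Ideal.Quotient.mk (Ideal.span {ϖ ^ k'})
  have hf : ∀ s, f s = 0 ↔ ϖ ^ k' ∣ s := fun s => by
    rw [Ideal.Quotient.eq_zero_iff_mem, Ideal.mem_span_singleton]
  have hf0 : f (ϖ ^ k') = 0 := (hf _).2 dvd_rfl
  have h2 := h.map_eq_map_of_smul_eq hl' f hf0 h1
  rw [Matrix.map_mul, Matrix.map_mul, kernelMatrix_map, kernelMatrix_eq_vecMulVec (ϖ := f ϖ)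
    (by rw [← map_pow, hf0])] at h2
  have h3 := eq_zero_of_mul_eq_vecMulVec (e := f e) (x := f (ϖ ^ k * x)) (y := f y)
    (p := f (ϖ ^ k * p)) (z := f (ϖ ^ k * z)) (isUnit_det_map f hX) (by
      rw [← h2]
      congr 1
      ext i i'
      fin_cases i <;> fin_cases i' <;> simp [kernelMatrix])
  rw [hf, hf, hf, hf] at h3
  refine ⟨h.le_of_pow_dvd_pow (by omega) ?_, ?_⟩
  · rcases hpz with rfl | rfl
    · simpa using h3.2.2.1
    · simpa using h3.2.2.2
  · rw [add_sub_cancel_left, pow_add]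
    exact mul_dvd_mul_left _ h3.1

/-- The parameters of a normal form are invariants of its class. -/
theorem normalForm_params_unique (h : IsUniserialOfLength R ϖ ℓ) [Finite (ResidueField R)]
    (hl : j + k + a = ℓ) (hl' : j' + k' + a' = ℓ) (hpz : p = 1 ∨ z = 1) (hpz' : p' = 1 ∨ z' = 1)
    (hd : d ∈ transversal ϖ (j + k)) (hd' : d' ∈ transversal ϖ (j' + k'))
    (hx : x ∈ transversal ϖ a) (hx' : x' ∈ transversal ϖ a')
    (hy : y ∈ transversal ϖ (k + a)) (hy' : y' ∈ transversal ϖ (k' + a'))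
    (hc : IsConj (normalForm ϖ j k d x y p z) (normalForm ϖ j' k' d' x' y' p' z')) :
    (j = j' ∧ k = k' ∧ a = a' ∧ d = d' ∧ x = x' ∧ y = y') ∧ ϖ ^ a ∣ p * z - p' * z' ∧
      ¬ (p = 1 ∧ z' = 1 ∧ 0 < k ∧ 0 < a ∧ ¬ IsUnit x ∧ ¬ IsUnit y ∧ ¬ IsUnit z ∧ ¬ IsUnit p') := by
  obtain ⟨U, hU⟩ := hc
  obtain ⟨V, hV⟩ : IsConj (normalForm ϖ j' k' d' x' y' p' z') (normalForm ϖ j k d x y p z) :=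
    IsConj.symm ⟨U, hU⟩
  have hUd := (Matrix.isUnit_iff_isUnit_det _).1 U.isUnit
  have hVd := (Matrix.isUnit_iff_isUnit_det _).1 V.isUnit
  obtain rfl : j = j' := le_antisymm
    (h.le_and_dvd_of_mul_normalForm_eq hVd (by omega) hV.eq).1
    (h.le_and_dvd_of_mul_normalForm_eq hUd (by omega) hU.eq).1
  have hk := h.le_and_dvd_of_mul_eq_mul hUd (by omega) (by omega) hpz hU.eq
  obtain rfl : k = k' := le_antisymm
    (h.le_and_dvd_of_mul_eq_mul hVd (by omega) (by omega) hpz' hV.eq).1 hk.1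
  obtain rfl : a = a' := by omega
  obtain rfl := h.eq_of_mem_transversal (by omega) hd hd' hk.2
  have h1 : ϖ ^ j • ((U : Matrix (Fin 3) (Fin 3) R) * kernelMatrix ϖ k x y p z) =
      ϖ ^ j • (kernelMatrix ϖ k x' y' p' z' * (U : Matrix (Fin 3) (Fin 3) R)) := by
    have := hU.eq
    simp only [normalForm, add_mul, mul_add, mul_smul_comm, smul_mul_assoc, mul_one,
      one_mul] at this
    exact add_left_cancel this
  -- Cancelling `ϖ ^ j` leaves precision `k + a`, enough for `y`; the coefficient `ϖ ^ k x` then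
  -- determines `x` to precision `a`.
  obtain ⟨hy1, hx1⟩ : ϖ ^ (k + a) ∣ y - y' ∧ ϖ ^ a ∣ x - x' := by
    let f := Ideal.Quotient.mk (Ideal.span {ϖ ^ (k + a)})
    have hf : ∀ s, f s = 0 ↔ ϖ ^ (k + a) ∣ s := fun s => by
      rw [Ideal.Quotient.eq_zero_iff_mem, Ideal.mem_span_singleton]
    have h2 := h.map_eq_map_of_smul_eq (n := k + a) (by omega) f ((hf _).2 dvd_rfl) h1
    rw [Matrix.map_mul, Matrix.map_mul, kernelMatrix_map, kernelMatrix_map] at h2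
    have h3 := trace_det_eq_of_mul_eq_mul (isUnit_det_map f hUd) h2
    rw [← map_pow, ← map_mul, ← map_mul, ← sub_eq_zero, ← map_sub, hf, ← sub_eq_zero, ← map_sub,
      hf, ← mul_sub] at h3
    exact ⟨h3.1, h.dvd_of_pow_mul_dvd (by omega) h3.2⟩
  obtain rfl := h.eq_of_mem_transversal (by omega) hx hx' hx1
  obtain rfl := h.eq_of_mem_transversal (by omega) hy hy' hy1
  have h1' := smul_dividedMatrix_eq h1
  have key : ∀ {S : Type _} [CommRing S] (f : R →+* S), f (ϖ ^ a) = 0 →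
      (U : Matrix (Fin 3) (Fin 3) R).map f * kernelMatrix (f ϖ) k (f x) (f y) (f p) (f z) =
        kernelMatrix (f ϖ) k (f x) (f y) (f p') (f z') * (U : Matrix (Fin 3) (Fin 3) R).map f ∧
      (U : Matrix (Fin 3) (Fin 3) R).map f * dividedMatrix (f ϖ) k (f x) (f y) (f p) (f z) =
        dividedMatrix (f ϖ) k (f x) (f y) (f p') (f z') *
          (U : Matrix (Fin 3) (Fin 3) R).map f := by
    intro S _ f hf
    have h2 := h.map_eq_map_of_smul_eq (n := a) (by omega) f hf h1
    have h3 := h.map_eq_map_of_smul_eq (n := a) (by omega) f hf h1'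
    rw [Matrix.map_mul, Matrix.map_mul, kernelMatrix_map, kernelMatrix_map] at h2
    rw [Matrix.map_mul, Matrix.map_mul, dividedMatrix_map, dividedMatrix_map] at h3
    exact ⟨h2, h3⟩
  refine ⟨⟨rfl, rfl, rfl, rfl, rfl, rfl⟩, ?_, ?_⟩
  · let f := Ideal.Quotient.mk (Ideal.span {ϖ ^ a})
    have hf : ∀ s, f s = 0 ↔ ϖ ^ a ∣ s := fun s => by
      rw [Ideal.Quotient.eq_zero_iff_mem, Ideal.mem_span_singleton]
    obtain ⟨h2, h3⟩ := key f ((hf _).2 dvd_rfl)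
    have := mul_eq_mul_of_dividedMatrix (isUnit_det_map f hUd) h2 h3
    rwa [← map_mul, ← map_mul, ← sub_eq_zero, ← map_sub, hf] at this
  · rintro ⟨rfl, rfl, hk0, ha0, hnx, hny, hnz, hnp⟩
    have hr : ∀ {s : R}, ¬ IsUnit s → residue R s = 0 := fun hs => by
      rwa [← residue_ne_zero_iff_isUnit, not_not] at hs
    obtain ⟨h2, h3⟩ := key (residue R) (by rw [map_pow, h.residue_eq_zero, zero_pow ha0.ne'])
    rw [hr hnx, hr hny, hr hnz, hr hnp, map_one] at h2 h3
    exact false_of_mul_dividedMatrix_eq_mul (by rw [h.residue_eq_zero, zero_pow hk0.ne'])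
      (isUnit_det_map _ hUd) h2 h3

end IsUniserialOfLength

/-! ### Counting conjugacy classes by representatives. -/

theorem card_conjClasses_eq {M ι : Type*} [Monoid M] (T : Finset ι) (f : ι → M)
    (hsurj : ∀ m, ∃ t ∈ T, IsConj m (f t))
    (hinj : ∀ t ∈ T, ∀ t' ∈ T, IsConj (f t) (f t') → t = t') :
    Nat.card (ConjClasses M) = T.card := by
  rw [← Nat.card_eq_finsetCard]
  symm
  refine Nat.card_eq_of_bijective (fun t : T => ConjClasses.mk (f t)) ⟨?_, ?_⟩
  · intro t t' ht
    exact Subtype.ext (hinj _ t.2 _ t'.2 (ConjClasses.mk_eq_mk_iff_isConj.1 ht))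
  · intro c
    obtain ⟨m, rfl⟩ := ConjClasses.exists_rep c
    obtain ⟨t, ht, hm⟩ := hsurj m
    exact ⟨⟨t, ht⟩, ConjClasses.mk_eq_mk_iff_isConj.2 hm.symm⟩

theorem Units.isConj_iff_isConj_val {M : Type*} [Monoid M] {u v : Mˣ} :
    IsConj u v ↔ IsConj (u : M) (v : M) := by
  constructor
  · rintro ⟨c, hc⟩
    exact ⟨c, by simpa [SemiconjBy, Units.ext_iff] using hc⟩
  · rintro ⟨c, hc⟩
    exact ⟨toUnits c, by simpa [SemiconjBy, Units.ext_iff] using hc⟩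

theorem IsConj.isUnit_iff {M : Type*} [Monoid M] {m n : M} (h : IsConj m n) :
    IsUnit m ↔ IsUnit n := by
  obtain ⟨c, hc⟩ := h
  rw [← Units.isUnit_units_mul c m, hc.eq, Units.isUnit_mul_units]

theorem card_conjClasses_units_eq {M ι : Type*} [Monoid M] (T : Finset ι) (f : ι → M)
    (hunit : ∀ t ∈ T, IsUnit (f t)) (hsurj : ∀ m, IsUnit m → ∃ t ∈ T, IsConj m (f t))
    (hinj : ∀ t ∈ T, ∀ t' ∈ T, IsConj (f t) (f t') → t = t') :
    Nat.card (ConjClasses Mˣ) = T.card := by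
  classical
  have hinj' : ∀ t ∈ T.attach, ∀ t' ∈ T.attach,
      IsConj (hunit t.1 t.2).unit (hunit t'.1 t'.2).unit → t = t' := by
    intro t _ t' _ h
    exact Subtype.ext (hinj _ t.2 _ t'.2 (by simpa using Units.isConj_iff_isConj_val.1 h))
  rw [card_conjClasses_eq T.attach (fun t => (hunit t.1 t.2).unit) ?_ hinj', Finset.card_attach]
  intro u
  obtain ⟨t, ht, h⟩ := hsurj u u.isUnit
  exact ⟨⟨t, ht⟩, Finset.mem_attach _ _, Units.isConj_iff_isConj_val.2 (by simpa using h)⟩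

/-! ### The finite set of normal forms. -/

section FormSet

variable {R : Type*} [CommRing R] [IsLocalRing R] [Finite (ResidueField R)]

/-- The two shapes of normal forms with parameters `d, x, y` and `s`. -/
def shapedForm {R : Type*} [CommRing R] (ϖ : R) (j k : ℕ) :
    Bool → R × R × R × R → Matrix (Fin 3) (Fin 3) R
  | true, t => normalForm ϖ j k t.1 t.2.1 t.2.2.1 1 t.2.2.2
  | false, t => normalForm ϖ j k t.1 t.2.1 t.2.2.1 t.2.2.2 1

open Classical in
/-- The admissible parameters `d, x, y, s` of the normal forms. -/
noncomputable def formParams (ϖ : R) (j k a : ℕ) : Bool → Finset (R × R × R × R)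
  | true => transversal ϖ (j + k) ×ˢ transversal ϖ a ×ˢ transversal ϖ (k + a) ×ˢ transversal ϖ a
  | false => if 0 < k ∧ 0 < a then
      transversal ϖ (j + k) ×ˢ (transversal ϖ a).filter (fun r => ¬ IsUnit r) ×ˢ
        (transversal ϖ (k + a)).filter (fun r => ¬ IsUnit r) ×ˢ
          (transversal ϖ a).filter (fun r => ¬ IsUnit r)
    else ∅

open Classical in
/-- The discrete and continuous parameters of all normal forms that satisfy `P`. -/
noncomputable def formSet (ϖ : R) (ℓ : ℕ) (P : Matrix (Fin 3) (Fin 3) R → Prop) :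
    Finset (Σ _ : ℕ × ℕ, Σ _ : ℕ × ℕ, Σ _ : Bool, R × R × R × R) :=
  (Finset.HasAntidiagonal.antidiagonal ℓ).sigma fun s => (Finset.HasAntidiagonal.antidiagonal s.2).sigma fun u =>
    (Finset.univ : Finset Bool).sigma fun τ =>
      (formParams ϖ s.1 u.1 u.2 τ).filter fun t => P (shapedForm ϖ s.1 u.1 τ t)

/-- The normal form with the given parameters. -/
def formOf (ϖ : R) (t : Σ _ : ℕ × ℕ, Σ _ : ℕ × ℕ, Σ _ : Bool, R × R × R × R) :
    Matrix (Fin 3) (Fin 3) R :=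
  shapedForm ϖ t.1.1 t.2.1.1 t.2.2.1 t.2.2.2

variable {ϖ : R} {ℓ : ℕ}

theorem mem_formSet {P : Matrix (Fin 3) (Fin 3) R → Prop} {j b k a : ℕ} {τ : Bool}
    {t : R × R × R × R} : ⟨(j, b), (k, a), τ, t⟩ ∈ formSet ϖ ℓ P ↔
      j + b = ℓ ∧ k + a = b ∧ t ∈ formParams ϖ j k a τ ∧ P (shapedForm ϖ j k τ t) := by
  simp [formSet]

theorem mem_formParams_true {j k a : ℕ} {d x y s : R} :
    (d, x, y, s) ∈ formParams ϖ j k a true ↔ d ∈ transversal ϖ (j + k) ∧ x ∈ transversal ϖ a ∧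
      y ∈ transversal ϖ (k + a) ∧ s ∈ transversal ϖ a := by
  simp [formParams]

theorem mem_formParams_false {j k a : ℕ} {d x y s : R} :
    (d, x, y, s) ∈ formParams ϖ j k a false ↔ (0 < k ∧ 0 < a) ∧ d ∈ transversal ϖ (j + k) ∧
      (x ∈ transversal ϖ a ∧ ¬ IsUnit x) ∧ (y ∈ transversal ϖ (k + a) ∧ ¬ IsUnit y) ∧
        (s ∈ transversal ϖ a ∧ ¬ IsUnit s) := by
  rw [formParams]
  split_ifs with h
  · simp [h]
  · simp only [Finset.notMem_empty, h, false_and]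

namespace IsUniserialOfLength

theorem exists_mem_formSet (h : IsUniserialOfLength R ϖ ℓ) {P : Matrix (Fin 3) (Fin 3) R → Prop}
    (hP : ∀ {M N}, IsConj M N → P M → P N) {M : Matrix (Fin 3) (Fin 3) R} (hM : P M) :
    ∃ t ∈ formSet ϖ ℓ P, IsConj M (formOf ϖ t) := by
  obtain ⟨j, k, a, hl, d, hd, x, hx, y, hy, s, hs, hc | ⟨hk, ha, hnx, hny, hns, hc⟩⟩ :=
    h.exists_isConj_normalForm M
  · exact ⟨⟨(j, k + a), (k, a), true, (d, x, y, s)⟩, mem_formSet.2 ⟨by omega, rfl,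
      mem_formParams_true.2 ⟨hd, hx, hy, hs⟩, hP hc hM⟩, hc⟩
  · exact ⟨⟨(j, k + a), (k, a), false, (d, x, y, s)⟩, mem_formSet.2 ⟨by omega, rfl,
      mem_formParams_false.2 ⟨⟨hk, ha⟩, hd, ⟨hx, hnx⟩, ⟨hy, hny⟩, hs, hns⟩, hP hc hM⟩, hc⟩

theorem eq_of_isConj_formOf (h : IsUniserialOfLength R ϖ ℓ)
    {P : Matrix (Fin 3) (Fin 3) R → Prop} {t t' : Σ _ : ℕ × ℕ, Σ _ : ℕ × ℕ, Σ _ : Bool, R × R × R × R}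
    (ht : t ∈ formSet ϖ ℓ P) (ht' : t' ∈ formSet ϖ ℓ P) (hc : IsConj (formOf ϖ t) (formOf ϖ t')) :
    t = t' := by
  obtain ⟨⟨j, b⟩, ⟨k, a⟩, τ, d, x, y, s⟩ := t
  obtain ⟨⟨j', b'⟩, ⟨k', a'⟩, τ', d', x', y', s'⟩ := t'
  obtain ⟨h1, rfl, h2, -⟩ := mem_formSet.1 ht
  obtain ⟨h1', rfl, h2', -⟩ := mem_formSet.1 ht'
  clear ht ht'
  cases τ <;> cases τ'
  · obtain ⟨⟨hk, ha⟩, hd, ⟨hx, hnx⟩, ⟨hy, hny⟩, hs, hns⟩ := mem_formParams_false.1 h2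
    obtain ⟨⟨hk', ha'⟩, hd', ⟨hx', hnx'⟩, ⟨hy', hny'⟩, hs', hns'⟩ := mem_formParams_false.1 h2'
    obtain ⟨⟨rfl, rfl, rfl, rfl, rfl, rfl⟩, he, -⟩ := h.normalForm_params_unique (by omega)
      (by omega) (Or.inr rfl) (Or.inr rfl) hd hd' hx hx' hy hy' hc
    rw [mul_one, mul_one] at he
    rw [h.eq_of_mem_transversal (by omega) hs hs' he]
  · obtain ⟨⟨hk, ha⟩, hd, ⟨hx, hnx⟩, ⟨hy, hny⟩, hs, hns⟩ := mem_formParams_false.1 h2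
    obtain ⟨hd', hx', hy', hs'⟩ := mem_formParams_true.1 h2'
    obtain ⟨⟨rfl, rfl, rfl, rfl, rfl, rfl⟩, he, hn⟩ := h.normalForm_params_unique (by omega)
      (by omega) (Or.inl rfl) (Or.inr rfl) hd' hd hx' hx hy' hy hc.symm
    rw [mul_one, one_mul] at he
    rw [h.eq_of_mem_transversal (by omega) hs' hs he] at hn
    exact absurd ⟨rfl, rfl, hk, ha, hnx, hny, hns, hns⟩ hn
  · obtain ⟨⟨hk, ha⟩, hd, ⟨hx, hnx⟩, ⟨hy, hny⟩, hs, hns⟩ := mem_formParams_false.1 h2'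
    obtain ⟨hd', hx', hy', hs'⟩ := mem_formParams_true.1 h2
    obtain ⟨⟨rfl, rfl, rfl, rfl, rfl, rfl⟩, he, hn⟩ := h.normalForm_params_unique (by omega)
      (by omega) (Or.inl rfl) (Or.inr rfl) hd' hd hx' hx hy' hy hc
    rw [mul_one, one_mul] at he
    rw [h.eq_of_mem_transversal (by omega) hs' hs he] at hn
    exact absurd ⟨rfl, rfl, hk, ha, hnx, hny, hns, hns⟩ hn
  · obtain ⟨hd, hx, hy, hs⟩ := mem_formParams_true.1 h2
    obtain ⟨hd', hx', hy', hs'⟩ := mem_formParams_true.1 h2'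
    obtain ⟨⟨rfl, rfl, rfl, rfl, rfl, rfl⟩, he, -⟩ := h.normalForm_params_unique (by omega)
      (by omega) (Or.inl rfl) (Or.inl rfl) hd hd' hx hx' hy hy' hc
    rw [one_mul, one_mul] at he
    rw [h.eq_of_mem_transversal (by omega) hs hs' he]

theorem numSimM3_eq_card (h : IsUniserialOfLength R ϖ ℓ) :
    numSimM3 R = (formSet ϖ ℓ fun _ => True).card :=
  card_conjClasses_eq _ (formOf ϖ) (fun _ => h.exists_mem_formSet (fun _ _ => trivial) trivial)
    fun _ ht _ ht' => h.eq_of_isConj_formOf ht ht'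

theorem numSimGL3_eq_card (h : IsUniserialOfLength R ϖ ℓ) :
    numSimGL3 R = (formSet ϖ ℓ IsUnit).card :=
  card_conjClasses_units_eq _ (formOf ϖ) (fun t ht => by
    obtain ⟨⟨j, b⟩, ⟨k, a⟩, τ, t⟩ := t
    exact (mem_formSet.1 ht).2.2.2)
    (fun _ => h.exists_mem_formSet fun hc => hc.isUnit_iff.1)
    fun _ ht _ ht' => h.eq_of_isConj_formOf ht ht'

end IsUniserialOfLength

end FormSet

/-! ### Summing the weights. -/

section Sums

open Finset.HasAntidiagonal Finset.Nat

theorem sub_mul_sum_antidiagonal_pow_mul_pow (x y : ℚ) (n : ℕ) :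
    (y - x) * ∑ u ∈ antidiagonal n, x ^ u.1 * y ^ u.2 = y ^ (n + 1) - x ^ (n + 1) := by
  induction n with
  | zero => simp
  | succ n ih =>
    have : ∑ u ∈ antidiagonal n, x ^ (u.1 + 1) * y ^ u.2 =
        x * ∑ u ∈ antidiagonal n, x ^ u.1 * y ^ u.2 := by
      rw [Finset.mul_sum]
      exact Finset.sum_congr rfl fun u _ => by ring
    rw [sum_antidiagonal_succ, this]
    linear_combination x * ih

/-- The number of parameters `x, y, s` of the normal forms with given `k` and `a`, multiplied by
`q ^ k`. -/
def formWeight (q : ℚ) (k a : ℕ) : ℚ :=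
  q ^ (2 * k + 3 * a) + if 0 < k ∧ 0 < a then q ^ (2 * k + 3 * a - 3) else 0

theorem sum_formWeight_succ {q : ℚ} (h0 : q ≠ 0) (h1 : q - 1 ≠ 0) (b : ℕ) :
    ∑ u ∈ antidiagonal (b + 1), formWeight q u.1 u.2 =
      (q ^ (3 * b) * (q ^ 4 + 1) - q ^ (2 * b) * (q ^ 2 + 1)) / (q - 1) := by
  have hA : ∀ n, (∑ u ∈ antidiagonal n, q ^ (2 * u.1 + 3 * u.2)) * (q - 1) =
      q ^ (3 * n + 1) - q ^ (2 * n) := by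
    intro n
    have h2 := sub_mul_sum_antidiagonal_pow_mul_pow (q ^ 2) (q ^ 3) n
    have h3 : ∑ u ∈ antidiagonal n, (q ^ 2) ^ u.1 * (q ^ 3) ^ u.2 =
        ∑ u ∈ antidiagonal n, q ^ (2 * u.1 + 3 * u.2) :=
      Finset.sum_congr rfl fun u _ => by rw [← pow_mul, ← pow_mul, pow_add]
    rw [h3] at h2
    refine mul_left_cancel₀ (pow_ne_zero 2 h0) ?_
    have e1 : (q ^ 3) ^ (n + 1) = q ^ 2 * q ^ (3 * n + 1) := by ring
    have e2 : (q ^ 2) ^ (n + 1) = q ^ 2 * q ^ (2 * n) := by ring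
    rw [e1, e2] at h2
    linear_combination h2
  have hB : (∑ u ∈ antidiagonal (b + 1),
      if 0 < u.1 ∧ 0 < u.2 then q ^ (2 * u.1 + 3 * u.2 - 3) else 0) * (q - 1) =
        q ^ (3 * b) - q ^ (2 * b) := by
    cases b with
    | zero => simp [sum_antidiagonal_succ]
    | succ b =>
      rw [sum_antidiagonal_succ, sum_antidiagonal_succ']
      have : ∑ u ∈ antidiagonal b, (if 0 < u.1 + 1 ∧ 0 < u.2 + 1 then
          q ^ (2 * (u.1 + 1) + 3 * (u.2 + 1) - 3) else 0) =
            q ^ 2 * ∑ u ∈ antidiagonal b, q ^ (2 * u.1 + 3 * u.2) := by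
        rw [Finset.mul_sum]
        refine Finset.sum_congr rfl fun u _ => ?_
        rw [if_pos ⟨by omega, by omega⟩, ← pow_add]
        congr 1
        omega
      simp only [this, lt_irrefl, false_and, and_false, if_false, zero_add]
      linear_combination q ^ 2 * hA b
  rw [eq_div_iff h1]
  simp only [formWeight, Finset.sum_add_distrib, add_mul]
  rw [hA, hB]
  ring

/-- The closed formula for the number of similarity classes in `M_3`. -/
theorem sum_pow_mul_formWeight {q : ℚ} (h0 : q ≠ 0) (h1 : q - 1 ≠ 0) (h2 : q ^ 2 - 1 ≠ 0) (ℓ : ℕ) :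
    ∑ s ∈ antidiagonal ℓ, q ^ s.1 * ∑ u ∈ antidiagonal s.2, formWeight q u.1 u.2 =
      ((q ^ 3 + q⁻¹) * q ^ (3 * ℓ) - (q ^ 2 + q + 1 + q⁻¹) * q ^ (2 * ℓ) + 2 * q ^ ℓ) /
        ((q - 1) * (q ^ 2 - 1)) := by
  induction ℓ with
  | zero =>
    simp [formWeight]
    field_simp
    ring
  | succ n ih =>
    have : ∑ s ∈ antidiagonal n, q ^ (s.1 + 1) * ∑ u ∈ antidiagonal s.2, formWeight q u.1 u.2 =
        q * ∑ s ∈ antidiagonal n, q ^ s.1 * ∑ u ∈ antidiagonal s.2, formWeight q u.1 u.2 := by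
      rw [Finset.mul_sum]
      exact Finset.sum_congr rfl fun u _ => by ring
    rw [sum_antidiagonal_succ, this, ih, sum_formWeight_succ h0 h1]
    field_simp
    ring

/-- The number of parameters `d, x, y, s` of the invertible normal forms with `j = 0`. -/
def unitFormWeight (q : ℚ) (k a : ℕ) : ℚ :=
  if k = 0 then q ^ (2 * a) * (q ^ a - q ^ (a - 1)) else
    (q ^ k - q ^ (k - 1)) * ((q ^ (k + a) - q ^ (k + a - 1)) * q ^ (2 * a) +
      if 0 < a then q ^ (k + a - 1) * q ^ (2 * a - 2) else 0)

/-- The truncated exponent `2 * n - 1` is harmless at `n = 0`, where the factor `q ^ n - 1`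
vanishes. -/
theorem sum_unitFormWeight_succ {q : ℚ} (h0 : q ≠ 0) (n : ℕ) :
    ∑ u ∈ antidiagonal (n + 1), unitFormWeight q u.1 u.2 =
      q ^ (3 * n + 2) * (q - 1) + (q - 1) * q ^ (2 * n) * (q ^ (n + 1) - 1) +
        q ^ (2 * n - 1) * (q ^ n - 1) := by
  have hT : ∀ n, (∑ u ∈ antidiagonal n, q ^ u.1 * q ^ (2 * u.2)) * (q - 1) =
      q ^ n * (q ^ (n + 1) - 1) := by
    intro n
    have h2 := sub_mul_sum_antidiagonal_pow_mul_pow q (q ^ 2) n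
    simp only [← pow_mul] at h2
    refine mul_left_cancel₀ h0 ?_
    linear_combination h2
  have hU : (∑ u ∈ antidiagonal n, q ^ u.1 * if 0 < u.2 then q ^ (2 * u.2 - 2) else 0) * (q - 1) =
      q ^ (n - 1) * (q ^ n - 1) := by
    cases n with
    | zero => simp
    | succ n =>
      rw [sum_antidiagonal_succ']
      have : ∑ u ∈ antidiagonal n,
          (q ^ u.1 * if 0 < u.2 + 1 then q ^ (2 * (u.2 + 1) - 2) else 0) =
            ∑ u ∈ antidiagonal n, q ^ u.1 * q ^ (2 * u.2) := by
        refine Finset.sum_congr rfl fun u _ => ?_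
        rw [if_pos (by omega)]
        congr 1
      simp only [this, lt_irrefl, if_false, mul_zero, zero_add, add_tsub_cancel_right]
      exact hT n
  have hmain : ∑ u ∈ antidiagonal n, unitFormWeight q (u.1 + 1) u.2 =
      (q - 1) ^ 2 * q ^ n * (∑ u ∈ antidiagonal n, q ^ u.1 * q ^ (2 * u.2)) +
        (q - 1) * q ^ n *
          ∑ u ∈ antidiagonal n, q ^ u.1 * if 0 < u.2 then q ^ (2 * u.2 - 2) else 0 := by
    rw [Finset.mul_sum, Finset.mul_sum, ← Finset.sum_add_distrib]
    refine Finset.sum_congr rfl fun u hu => ?_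
    obtain rfl : u.1 + u.2 = n := by simpa using hu
    have e : u.1 + 1 + u.2 - 1 = u.1 + u.2 := by omega
    rw [unitFormWeight, if_neg (by omega), e, add_tsub_cancel_right]
    split_ifs <;> ring
  rw [sum_antidiagonal_succ, hmain, unitFormWeight, if_pos rfl, add_tsub_cancel_right]
  have e2 : q ^ n * (q ^ (n - 1) * (q ^ n - 1)) = q ^ (2 * n - 1) * (q ^ n - 1) := by
    rw [← mul_assoc, ← pow_add]
    cases n with
    | zero => simp
    | succ n => congr 2; omega
  linear_combination (q - 1) * q ^ n * hT n + q ^ n * hU + e2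

theorem sum_formWeight_units {q : ℚ} (h0 : q ≠ 0) (h1 : q - 1 ≠ 0) (h2 : q ^ 2 - 1 ≠ 0) (n : ℕ) :
    ∑ u ∈ antidiagonal (n + 1), unitFormWeight q u.1 u.2 +
      ∑ s ∈ antidiagonal n, (q ^ (s.1 + 1) - q ^ s.1) *
        ∑ u ∈ antidiagonal s.2, formWeight q u.1 u.2 =
      ((q ^ 2 - 1 + 2 * (q ^ 2)⁻¹) * q ^ (3 * (n + 1)) -
        (q + q⁻¹ + 2 * (q ^ 2)⁻¹) * q ^ (2 * (n + 1)) + 2 * q⁻¹ * q ^ (n + 1)) / (q ^ 2 - 1) := by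
  have : ∑ s ∈ antidiagonal n, (q ^ (s.1 + 1) - q ^ s.1) *
      ∑ u ∈ antidiagonal s.2, formWeight q u.1 u.2 =
        (q - 1) * ∑ s ∈ antidiagonal n, q ^ s.1 *
          ∑ u ∈ antidiagonal s.2, formWeight q u.1 u.2 := by
    rw [Finset.mul_sum]
    exact Finset.sum_congr rfl fun u _ => by ring
  rw [this, sum_pow_mul_formWeight h0 h1 h2, sum_unitFormWeight_succ h0]
  cases n with
  | zero => simp; field_simp; ring
  | succ n =>
    rw [show 2 * (n + 1) - 1 = 2 * n + 1 by omega]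
    field_simp
    ring

end Sums

/-! ### Counting all forms and the invertible ones. -/

section Count

theorem det_normalForm {R : Type*} [CommRing R] (ϖ : R) (j k : ℕ) (d x y p z : R) :
    (normalForm ϖ j k d x y p z).det =
      d * d * (d + ϖ ^ j * y) - ϖ ^ (j + j + k) * x * d + ϖ ^ (j + j + j + k + k) * (p * z) := by
  simp [normalForm, kernelMatrix, Matrix.det_fin_three]
  ring

/-- The condition on the third coordinate depends on the first, but its number of solutions does
not, so the count still factors. It is applied to the conditions that `d` and `d + y` are units. -/
theorem card_filter_product_and {α β γ δ : Type*} (s : Finset α) (t : Finset β) (u : Finset γ)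
    (v : Finset δ) {p : α × β × γ × δ → Prop} [DecidablePred p] (P : α → Prop) [DecidablePred P]
    (Q : α → γ → Prop) [∀ d, DecidablePred (Q d)] (m : ℚ)
    (hm : ∀ d, ((u.filter (Q d)).card : ℚ) = m)
    (hp : ∀ r ∈ s ×ˢ t ×ˢ u ×ˢ v, p r ↔ P r.1 ∧ Q r.1 r.2.2.1) :
    (((s ×ˢ t ×ˢ u ×ˢ v).filter p).card : ℚ) = (s.filter P).card * (t.card * (m * v.card)) := by
  have : (((s.filter P).sigma fun d => t ×ˢ u.filter (Q d) ×ˢ v).card : ℚ) =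
      (s.filter P).card * (t.card * (m * v.card)) := by
    simp [Finset.card_sigma, Finset.card_product, hm]
  rw [← this, Finset.filter_congr hp]
  congr 1
  refine Finset.card_bij' (fun r _ => ⟨r.1, r.2⟩) (fun r _ => (r.1, r.2)) ?_ ?_ ?_ ?_
  · simp +contextual
  · simp +contextual
  · simp
  · simp

theorem card_filter_product_fst {α β γ δ : Type*} (s : Finset α) (t : Finset β) (u : Finset γ)
    (v : Finset δ) {p : α × β × γ × δ → Prop} [DecidablePred p] (P : α → Prop) [DecidablePred P]
    (hp : ∀ r ∈ s ×ˢ t ×ˢ u ×ˢ v, p r ↔ P r.1) :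
    (((s ×ˢ t ×ˢ u ×ˢ v).filter p).card : ℚ) =
      (s.filter P).card * (t.card * (u.card * v.card)) :=
  card_filter_product_and s t u v P (fun _ _ => True) u.card (by simp) (by simpa using hp)

variable {R : Type*} [CommRing R] [IsLocalRing R] {ϖ : R} {ℓ : ℕ}

theorem IsLocalRing.isUnit_add_iff_of_not_isUnit {d y : R} (hy : ¬ IsUnit y) :
    IsUnit (d + y) ↔ IsUnit d := by
  rw [← residue_ne_zero_iff_isUnit, not_not] at hy
  rw [← residue_ne_zero_iff_isUnit, map_add, hy, add_zero, residue_ne_zero_iff_isUnit]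

namespace IsUniserialOfLength

theorem residue_det_normalForm_zero_right (h : IsUniserialOfLength R ϖ ℓ) {j k : ℕ}
    (hjk : 0 < j + k) (d x y p z : R) : residue R (normalForm ϖ j k d x y p z).det =
      residue R d * residue R d * residue R (d + ϖ ^ j * y) := by
  rw [det_normalForm, map_add, map_sub, map_mul, map_mul, map_mul (residue R) _ (p * z),
    map_mul (residue R) _ d, map_mul (residue R) _ x, map_pow, map_pow, h.residue_eq_zero,
    zero_pow (by omega), zero_pow (by omega)]
  ring

theorem isUnit_normalForm_iff (h : IsUniserialOfLength R ϖ ℓ) {j k : ℕ} (hjk : 0 < j + k)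
    (d x y p z : R) :
    IsUnit (normalForm ϖ j k d x y p z) ↔ IsUnit d ∧ IsUnit (d + ϖ ^ j * y) := by
  rw [Matrix.isUnit_iff_isUnit_det, ← residue_ne_zero_iff_isUnit,
    h.residue_det_normalForm_zero_right hjk, mul_ne_zero_iff, mul_self_ne_zero,
    residue_ne_zero_iff_isUnit, residue_ne_zero_iff_isUnit]

theorem isUnit_normalForm_succ_iff (h : IsUniserialOfLength R ϖ ℓ) (j k : ℕ) (d x y p z : R) :
    IsUnit (normalForm ϖ (j + 1) k d x y p z) ↔ IsUnit d := by
  rw [h.isUnit_normalForm_iff (by omega), isUnit_add_iff_of_not_isUnit, and_self]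
  rw [h.not_isUnit_iff]
  exact (dvd_pow_self ϖ j.succ_ne_zero).mul_right y

variable [Finite (ResidueField R)]

open Classical in
theorem card_filter_not_isUnit (h : IsUniserialOfLength R ϖ ℓ) {n : ℕ} (hn : n + 1 ≤ ℓ) :
    ((transversal ϖ (n + 1)).filter fun r => ¬ IsUnit r).card =
      Nat.card (ResidueField R) ^ n := by
  simpa using h.card_filter_not_isUnit_add hn 0

open Classical in
theorem card_filter_isUnit (h : IsUniserialOfLength R ϖ ℓ) {n : ℕ} (hn : n + 1 ≤ ℓ) :
    (((transversal ϖ (n + 1)).filter fun r => IsUnit r).card : ℚ) =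
      (Nat.card (ResidueField R) : ℚ) ^ (n + 1) - (Nat.card (ResidueField R) : ℚ) ^ n := by
  simpa using h.card_filter_isUnit_add hn 0

theorem card_filter_formParams_true (h : IsUniserialOfLength R ϖ ℓ) {j k a : ℕ}
    (hl : j + k + a = ℓ) {p : R × R × R × R → Prop} [DecidablePred p] (P : R → Prop)
    [DecidablePred P] (hp : ∀ t ∈ formParams ϖ j k a true, p t ↔ P t.1) :
    (((formParams ϖ j k a true).filter p).card : ℚ) =
      ((transversal ϖ (j + k)).filter P).card *
        (Nat.card (ResidueField R) : ℚ) ^ (k + 3 * a) := by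
  rw [formParams] at hp ⊢
  rw [card_filter_product_fst _ _ _ _ P hp, h.card_transversal (by omega),
    h.card_transversal (by omega)]
  push_cast
  ring

theorem card_filter_formParams_false (h : IsUniserialOfLength R ϖ ℓ) {j k a : ℕ}
    (hl : j + k + a = ℓ) {p : R × R × R × R → Prop} [DecidablePred p] (P : R → Prop)
    [DecidablePred P] (hp : ∀ t ∈ formParams ϖ j k a false, p t ↔ P t.1) :
    (((formParams ϖ j k a false).filter p).card : ℚ) =
      ((transversal ϖ (j + k)).filter P).card *
        if 0 < k ∧ 0 < a then (Nat.card (ResidueField R) : ℚ) ^ (k + 3 * a - 3) else 0 := by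
  rw [formParams] at hp ⊢
  split_ifs at hp ⊢ with hka
  · obtain ⟨k, rfl⟩ := Nat.exists_eq_succ_of_ne_zero hka.1.ne'
    obtain ⟨a, rfl⟩ := Nat.exists_eq_succ_of_ne_zero hka.2.ne'
    rw [card_filter_product_fst _ _ _ _ P hp, Nat.succ_eq_add_one, Nat.succ_eq_add_one,
      show k + 1 + (a + 1) = k + a + 1 + 1 by ring,
      h.card_filter_not_isUnit (by omega), h.card_filter_not_isUnit (by omega),
      show k + 1 + 3 * (a + 1) - 3 = (k + a + 1) + 2 * a by omega]
    push_cast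
    ring
  · simp

open Classical in
theorem card_formSet (ϖ : R) (ℓ : ℕ) (P : Matrix (Fin 3) (Fin 3) R → Prop) :
    ((formSet ϖ ℓ P).card : ℚ) = ∑ s ∈ Finset.HasAntidiagonal.antidiagonal ℓ,
      ∑ u ∈ Finset.HasAntidiagonal.antidiagonal s.2,
        ((((formParams ϖ s.1 u.1 u.2 true).filter
            fun t => P (shapedForm ϖ s.1 u.1 true t)).card : ℚ) +
          ((formParams ϖ s.1 u.1 u.2 false).filter
            fun t => P (shapedForm ϖ s.1 u.1 false t)).card) := by
  simp [formSet, Finset.card_sigma]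

theorem card_formSet_true (h : IsUniserialOfLength R ϖ ℓ) :
    ((formSet ϖ ℓ fun _ => True).card : ℚ) = ∑ s ∈ Finset.HasAntidiagonal.antidiagonal ℓ,
      (Nat.card (ResidueField R) : ℚ) ^ s.1 * ∑ u ∈ Finset.HasAntidiagonal.antidiagonal s.2,
        formWeight (Nat.card (ResidueField R) : ℚ) u.1 u.2 := by
  classical
  rw [card_formSet]
  refine Finset.sum_congr rfl fun s hs => ?_
  rw [Finset.mul_sum]
  refine Finset.sum_congr rfl fun u hu => ?_
  rw [Finset.HasAntidiagonal.mem_antidiagonal] at hs hu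
  have h1 := h.card_filter_formParams_true (j := s.1) (k := u.1) (a := u.2) (by omega)
    (fun _ => True) fun _ _ => Iff.rfl
  have h2 := h.card_filter_formParams_false (j := s.1) (k := u.1) (a := u.2) (by omega)
    (fun _ => True) fun _ _ => Iff.rfl
  simp only [Finset.filter_true] at h1 h2 ⊢
  rw [h1, h2, h.card_transversal (by omega), formWeight]
  push_cast
  split_ifs with hka
  · rw [show 2 * u.1 + 3 * u.2 - 3 = u.1 + (u.1 + 3 * u.2 - 3) by omega]
    ring
  · ring

open Classical in
theorem card_filter_isUnit_succ (h : IsUniserialOfLength R ϖ ℓ) {j k a : ℕ}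
    (hl : j + 1 + k + a = ℓ) :
    (((formParams ϖ (j + 1) k a true).filter
        fun t => IsUnit (shapedForm ϖ (j + 1) k true t)).card : ℚ) +
      ((formParams ϖ (j + 1) k a false).filter
        fun t => IsUnit (shapedForm ϖ (j + 1) k false t)).card =
      ((Nat.card (ResidueField R) : ℚ) ^ (j + 1) - (Nat.card (ResidueField R) : ℚ) ^ j) *
        formWeight (Nat.card (ResidueField R) : ℚ) k a := by
  rw [h.card_filter_formParams_true (p := fun t => IsUnit (shapedForm ϖ (j + 1) k true t)) hl IsUnit
      fun t _ => h.isUnit_normalForm_succ_iff j k _ _ _ _ _,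
    h.card_filter_formParams_false (p := fun t => IsUnit (shapedForm ϖ (j + 1) k false t)) hl IsUnit
      fun t _ => h.isUnit_normalForm_succ_iff j k _ _ _ _ _,
    add_right_comm, h.card_filter_isUnit (by omega), formWeight]
  split_ifs with hka
  · rw [show 2 * k + 3 * a - 3 = k + (k + 3 * a - 3) by omega]
    ring
  · ring

open Classical in
theorem card_filter_isUnit_zero (h : IsUniserialOfLength R ϖ ℓ) (hℓ : 0 < ℓ) {k a : ℕ}
    (hl : k + a = ℓ) :
    (((formParams ϖ 0 k a true).filter fun t => IsUnit (shapedForm ϖ 0 k true t)).card : ℚ) +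
      ((formParams ϖ 0 k a false).filter fun t => IsUnit (shapedForm ϖ 0 k false t)).card =
      unitFormWeight (Nat.card (ResidueField R) : ℚ) k a := by
  rw [unitFormWeight]
  by_cases hk : k = 0
  · rw [if_pos hk]
    subst hk
    obtain ⟨a, rfl⟩ := Nat.exists_eq_succ_of_ne_zero (show a ≠ 0 by omega)
    -- For `j = k = 0` the only scalar is `d = 0`, and the determinant is the last parameter.
    have : (formParams ϖ 0 0 (a + 1) true).filter (fun t => IsUnit (shapedForm ϖ 0 0 true t)) =
        ({0} : Finset R) ×ˢ transversal ϖ (a + 1) ×ˢ transversal ϖ (0 + (a + 1)) ×ˢ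
          (transversal ϖ (a + 1)).filter IsUnit := by
      ext ⟨d, x, y, s⟩
      rw [Finset.mem_filter, mem_formParams_true, shapedForm, Matrix.isUnit_iff_isUnit_det,
        det_normalForm]
      simp only [Finset.mem_product, Finset.mem_filter, Finset.mem_singleton, add_zero,
        mem_transversal_zero]
      constructor
      · rintro ⟨⟨rfl, h2⟩, h3⟩
        simp at h3
        tauto
      · rintro ⟨rfl, h2⟩
        simp only [zero_add] at h2 ⊢
        simp
        tauto
    rw [Nat.succ_eq_add_one, this]
    simp only [Finset.card_product, Finset.card_singleton]
    push_cast
    rw [h.card_filter_isUnit (by omega), h.card_transversal (by omega),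
      h.card_transversal (by omega)]
    simp [formParams]
    ring
  · rw [if_neg hk]
    obtain ⟨k, rfl⟩ := Nat.exists_eq_succ_of_ne_zero hk
    rw [Nat.succ_eq_add_one] at *
    have hiff : ∀ d x y p z : R, IsUnit (normalForm ϖ 0 (k + 1) d x y p z) ↔
        IsUnit d ∧ IsUnit (d + y) := fun d x y p z => by
      rw [h.isUnit_normalForm_iff (by omega), pow_zero, one_mul]
    rw [h.card_filter_formParams_false
      (p := fun t => IsUnit (shapedForm ϖ 0 (k + 1) false t)) (by omega) IsUnit fun t ht => by
        obtain ⟨d, x, y, s⟩ := t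
        have hy := (mem_formParams_false.1 ht).2.2.2.1.2
        exact (hiff _ _ _ _ _).trans (by rw [isUnit_add_iff_of_not_isUnit hy, and_self]),
      formParams,
      show k + 1 + a = k + a + 1 by ring,
      card_filter_product_and (p := fun t => IsUnit (shapedForm ϖ 0 (k + 1) true t))
        _ _ _ _ IsUnit (fun d y => IsUnit (d + y)) _
        (fun d => h.card_filter_isUnit_add (n := k + a) (by omega) d) fun t _ => hiff _ _ _ _ _,
      show 0 + (k + 1) = k + 1 by ring, h.card_filter_isUnit (by omega),
      h.card_transversal (by omega), add_tsub_cancel_right,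
      add_tsub_cancel_right]
    push_cast
    by_cases ha : 0 < a
    · rw [if_pos ⟨by omega, ha⟩, if_pos ha,
        show k + 1 + 3 * a - 3 = k + a + (2 * a - 2) by omega]
      ring
    · rw [if_neg (by tauto), if_neg ha]
      ring

theorem card_formSet_isUnit (h : IsUniserialOfLength R ϖ (ℓ + 1)) :
    ((formSet ϖ (ℓ + 1) IsUnit).card : ℚ) =
      ∑ u ∈ Finset.HasAntidiagonal.antidiagonal (ℓ + 1),
        unitFormWeight (Nat.card (ResidueField R) : ℚ) u.1 u.2 +
      ∑ s ∈ Finset.HasAntidiagonal.antidiagonal ℓ, ((Nat.card (ResidueField R) : ℚ) ^ (s.1 + 1) -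
        (Nat.card (ResidueField R) : ℚ) ^ s.1) * ∑ u ∈ Finset.HasAntidiagonal.antidiagonal s.2,
          formWeight (Nat.card (ResidueField R) : ℚ) u.1 u.2 := by
  classical
  rw [card_formSet, Finset.Nat.sum_antidiagonal_succ]
  congr 1
  · refine Finset.sum_congr rfl fun u hu => ?_
    rw [Finset.HasAntidiagonal.mem_antidiagonal] at hu
    exact h.card_filter_isUnit_zero (by omega) hu
  · refine Finset.sum_congr rfl fun s hs => ?_
    rw [Finset.mul_sum]
    refine Finset.sum_congr rfl fun u hu => ?_
    rw [Finset.HasAntidiagonal.mem_antidiagonal] at hs hu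
    exact h.card_filter_isUnit_succ (by omega)

end IsUniserialOfLength

end Count

/-! ### The quotients as uniserial rings. -/

section LevelQuotient

variable {A : Type*} [CommRing A] [IsLocalRing A] {i : ℕ}

theorem nontrivial_levelQuotient (hi : 1 ≤ i) : Nontrivial (LevelQuotient A i) :=
  Ideal.Quotient.nontrivial_iff.2 fun h =>
    (maximalIdeal.isMaximal A).ne_top (top_le_iff.1 (h ▸ Ideal.pow_le_self (by omega)))

theorem isLocalRing_levelQuotient (hi : 1 ≤ i) : IsLocalRing (LevelQuotient A i) :=
  have := nontrivial_levelQuotient (A := A) hi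
  IsLocalRing.of_surjective' (Ideal.Quotient.mk _) Ideal.Quotient.mk_surjective

theorem exists_isUniserialOfLength_levelQuotient [IsPrincipalIdealRing A]
    (hl : (i : ℕ∞) ≤ localLength A) [IsLocalRing (LevelQuotient A i)] :
    ∃ ϖ : LevelQuotient A i, IsUniserialOfLength (LevelQuotient A i) ϖ i := by
  obtain ⟨π, hπ⟩ := (IsPrincipalIdealRing.principal (maximalIdeal A)).principal
  rw [Ideal.submodule_span_eq] at hπ
  have hmem : ∀ x, x ∈ maximalIdeal A ^ i ↔ π ^ i ∣ x := fun x => by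
    rw [hπ, Ideal.span_singleton_pow, Ideal.mem_span_singleton]
  have hz : (Ideal.Quotient.mk (maximalIdeal A ^ i) π) ^ i = 0 := by
    rw [← map_pow, Ideal.Quotient.eq_zero_iff_mem, hmem]
  refine ⟨Ideal.Quotient.mk _ π, ?_, hz, ?_⟩
  · refine le_antisymm ?_ ?_
    · intro x hx
      obtain ⟨a, rfl⟩ := Ideal.Quotient.mk_surjective x
      have ha : a ∈ maximalIdeal A := by
        rw [mem_maximalIdeal, mem_nonunits_iff] at hx ⊢
        exact fun h => hx (h.map _)
      rw [hπ, Ideal.mem_span_singleton] at ha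
      exact Ideal.mem_span_singleton.2 (map_dvd _ ha)
    · rw [Ideal.span_singleton_le_iff_mem, mem_maximalIdeal, mem_nonunits_iff]
      intro h
      have := h.pow i
      rw [hz] at this
      exact not_isUnit_zero this
  · intro n hn h0
    rw [← map_pow, Ideal.Quotient.eq_zero_iff_mem, hmem] at h0
    obtain ⟨c, hc⟩ := h0
    -- If `ϖ ^ n = 0` with `n < i`, this unit yields `π ^ n = 0` already in `A`, contradicting the
    -- bound on the length.
    have hu : IsUnit (1 - π ^ (i - n) * c) := by
      have h1 : ¬ IsUnit (π ^ (i - n) * c) := by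
        rw [← mem_nonunits_iff, ← mem_maximalIdeal, hπ, Ideal.mem_span_singleton]
        exact (dvd_pow_self π (by omega)).mul_right c
      exact (isUnit_or_isUnit_one_sub_self _).resolve_left h1
    have hn0 : π ^ n = 0 := by
      refine (hu.mul_left_eq_zero).1 ?_
      have : π ^ i = π ^ n * π ^ (i - n) := by rw [← pow_add]; congr 1; omega
      rw [this] at hc
      linear_combination hc
    have hpos : 0 < n := by
      rcases Nat.eq_zero_or_pos n with rfl | h
      · simp at hn0
      · exact h
    have hle : localLength A ≤ n := iInf₂_le n ⟨hpos, by
      rw [hπ, Ideal.span_singleton_pow, hn0, Ideal.span_singleton_eq_bot]⟩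
    exact absurd (hl.trans hle) (by simpa using hn)

theorem card_residueField_levelQuotient [IsLocalRing (LevelQuotient A i)] :
    Nat.card (ResidueField (LevelQuotient A i)) = Nat.card (ResidueField A) := by
  let f : A →+* ResidueField (LevelQuotient A i) :=
    (residue (LevelQuotient A i)).comp (Ideal.Quotient.mk (maximalIdeal A ^ i))
  have hf : Function.Surjective f := residue_surjective.comp Ideal.Quotient.mk_surjective
  have hker : maximalIdeal A = RingHom.ker f :=
    (eq_maximalIdeal (RingHom.ker_isMaximal_of_surjective f hf)).symm
  exact Nat.card_congr ((RingHom.quotientKerEquivOfSurjective hf).symm.trans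
    (Ideal.quotEquivOfEq hker.symm)).toEquiv

theorem numSimM3_levelQuotient_zero : numSimM3 (LevelQuotient A 0) = 1 := by
  have : Subsingleton (LevelQuotient A 0) := by
    rw [Ideal.Quotient.subsingleton_iff, pow_zero, Ideal.one_eq_top]
  have : Subsingleton (ConjClasses (Matrix (Fin 3) (Fin 3) (LevelQuotient A 0))) :=
    (ConjClasses.mk_surjective).subsingleton
  rw [numSimM3, Nat.card_eq_one_iff_unique]
  exact ⟨inferInstance, ⟨ConjClasses.mk 1⟩⟩

variable [Finite (ResidueField A)] {q : ℕ}

theorem two_le_card_residueField (hq : Nat.card (ResidueField A) = q) : 2 ≤ q := by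
  rw [← hq]
  exact Finite.one_lt_card

theorem cast_sub_one_ne_zero (hq : 2 ≤ q) :
    (q : ℚ) ≠ 0 ∧ (q : ℚ) - 1 ≠ 0 ∧ (q : ℚ) ^ 2 - 1 ≠ 0 := by
  have h : (2 : ℚ) ≤ q := by exact_mod_cast hq
  refine ⟨by positivity, by linarith, ?_⟩
  nlinarith

theorem numSimM3_levelQuotient [IsPrincipalIdealRing A]
    (hq : Nat.card (ResidueField A) = q) (hi : 1 ≤ i)
    (hl : (i : ℕ∞) ≤ localLength A) : (numSimM3 (LevelQuotient A i) : ℚ) =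
      (((q : ℚ) ^ 3 + (q : ℚ)⁻¹) * (q : ℚ) ^ (3 * i) -
        ((q : ℚ) ^ 2 + q + 1 + (q : ℚ)⁻¹) * (q : ℚ) ^ (2 * i) + 2 * (q : ℚ) ^ i) /
        (((q : ℚ) - 1) * ((q : ℚ) ^ 2 - 1)) := by
  obtain ⟨h0, h1, h2⟩ := cast_sub_one_ne_zero (two_le_card_residueField hq)
  have := isLocalRing_levelQuotient (A := A) hi
  obtain ⟨ϖ, h⟩ := exists_isUniserialOfLength_levelQuotient hl
  have hc := (card_residueField_levelQuotient (A := A) (i := i)).trans hq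
  have : Finite (ResidueField (LevelQuotient A i)) :=
    Nat.finite_of_card_ne_zero (by rw [hc]; exact_mod_cast h0)
  rw [h.numSimM3_eq_card, h.card_formSet_true, hc, sum_pow_mul_formWeight h0 h1 h2]

theorem numSimGL3_levelQuotient [IsPrincipalIdealRing A]
    (hq : Nat.card (ResidueField A) = q) (hi : 1 ≤ i)
    (hl : (i : ℕ∞) ≤ localLength A) : (numSimGL3 (LevelQuotient A i) : ℚ) =
      (((q : ℚ) ^ 2 - 1 + 2 * ((q : ℚ) ^ 2)⁻¹) * (q : ℚ) ^ (3 * i) -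
        ((q : ℚ) + (q : ℚ)⁻¹ + 2 * ((q : ℚ) ^ 2)⁻¹) * (q : ℚ) ^ (2 * i) +
          2 * (q : ℚ)⁻¹ * (q : ℚ) ^ i) / ((q : ℚ) ^ 2 - 1) := by
  obtain ⟨h0, h1, h2⟩ := cast_sub_one_ne_zero (two_le_card_residueField hq)
  have := isLocalRing_levelQuotient (A := A) hi
  obtain ⟨ϖ, h⟩ := exists_isUniserialOfLength_levelQuotient hl
  have hc := (card_residueField_levelQuotient (A := A) (i := i)).trans hq
  have : Finite (ResidueField (LevelQuotient A i)) :=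
    Nat.finite_of_card_ne_zero (by rw [hc]; exact_mod_cast h0)
  obtain ⟨i, rfl⟩ := Nat.exists_eq_succ_of_ne_zero (show i ≠ 0 by omega)
  rw [Nat.succ_eq_add_one] at *
  rw [h.numSimGL3_eq_card, h.card_formSet_isUnit, hc, sum_formWeight_units h0 h1 h2]

end LevelQuotient

/-! ### Generating functions and the final statement. -/

theorem coeff_geomSeries (a : ℚ) (n : ℕ) : PowerSeries.coeff n (geomSeries a) = a ^ n := by
  have : geomSeries a = PowerSeries.mk fun n => a ^ n := by
    rw [geomSeries, eq_comm, PowerSeries.eq_inv_iff_mul_eq_one (by simp)]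
    ext n
    rw [mul_sub, mul_one, mul_comm (PowerSeries.C a), ← mul_assoc]
    cases n with
    | zero => simp
    | succ n => simp [PowerSeries.coeff_succ_mul_X, PowerSeries.coeff_one, pow_succ]
  rw [this, PowerSeries.coeff_mk]

end

theorem mainTheorem1
    {A : Type*} [CommRing A] [IsLocalRing A] [IsPrincipalIdealRing A]
    [Finite (IsLocalRing.ResidueField A)]
    (q : ℕ) (hq : Nat.card (IsLocalRing.ResidueField A) = q) :
    -- the number of classes at every level `1 ≤ i ≤ ℓ`
    (∀ i : ℕ, 1 ≤ i → (i : ℕ∞) ≤ localLength A →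
      (numSimM3 (LevelQuotient A i) : ℚ) =
        ((q : ℚ) ^ (3 * (i : ℤ) + 3) + (q : ℚ) ^ (3 * (i : ℤ) - 1)
          - (q : ℚ) ^ (2 * (i : ℤ) + 2) - (q : ℚ) ^ (2 * (i : ℤ) + 1)
          - (q : ℚ) ^ (2 * (i : ℤ)) - (q : ℚ) ^ (2 * (i : ℤ) - 1) + 2 * (q : ℚ) ^ (i : ℤ))
          / (((q : ℚ) - 1) * ((q : ℚ) ^ 2 - 1)) ∧
      (numSimGL3 (LevelQuotient A i) : ℚ) =
        ((q : ℚ) ^ (3 * (i : ℤ) + 2) - (q : ℚ) ^ (3 * (i : ℤ))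
          + 2 * (q : ℚ) ^ (3 * (i : ℤ) - 2) - (q : ℚ) ^ (2 * (i : ℤ) + 1)
          - (q : ℚ) ^ (2 * (i : ℤ) - 1) - 2 * (q : ℚ) ^ (2 * (i : ℤ) - 2)
          + 2 * (q : ℚ) ^ ((i : ℤ) - 1))
          / ((q : ℚ) ^ 2 - 1)) ∧
    -- the generating functions, when all levels exist
    (localLength A = ⊤ →
      PowerSeries.mk (fun i : ℕ => (numSimM3 (LevelQuotient A i) : ℚ)) =
        PowerSeries.C (1 / (((q : ℚ) - 1) * ((q : ℚ) ^ 2 - 1))) *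
          (PowerSeries.C ((q : ℚ) ^ 3 + (q : ℚ)⁻¹) * geomSeries ((q : ℚ) ^ 3)
            - PowerSeries.C ((q : ℚ) ^ 2 + (q : ℚ) + 1 + (q : ℚ)⁻¹) * geomSeries ((q : ℚ) ^ 2)
            + PowerSeries.C 2 * geomSeries (q : ℚ)) ∧
      -- the term at `i = 0` is the value at `i = 0` of the closed formula
      PowerSeries.mk (fun i : ℕ =>
          if i = 0 then 1 - (q : ℚ)⁻¹ else (numSimGL3 (LevelQuotient A i) : ℚ)) =
        PowerSeries.C (1 / ((q : ℚ) ^ 2 - 1)) *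
          (PowerSeries.C ((q : ℚ) ^ 2 - 1 + 2 * ((q : ℚ) ^ 2)⁻¹) * geomSeries ((q : ℚ) ^ 3)
            - PowerSeries.C ((q : ℚ) + (q : ℚ)⁻¹ + 2 * ((q : ℚ) ^ 2)⁻¹) * geomSeries ((q : ℚ) ^ 2)
            + PowerSeries.C (2 * (q : ℚ)⁻¹) * geomSeries (q : ℚ))) ∧
    -- the counts depend on the ring only through `q`
    (∀ (B : Type*) [CommRing B] [IsLocalRing B] [IsPrincipalIdealRing B],
      Nat.card (IsLocalRing.ResidueField B) = q →
      ∀ i : ℕ, 1 ≤ i → (i : ℕ∞) ≤ localLength A → (i : ℕ∞) ≤ localLength B →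
        numSimM3 (LevelQuotient A i) = numSimM3 (LevelQuotient B i) ∧
        numSimGL3 (LevelQuotient A i) = numSimGL3 (LevelQuotient B i)) := by

  obtain ⟨h0, h1, h2⟩ := cast_sub_one_ne_zero (two_le_card_residueField hq)
  refine ⟨fun i hi hl => ⟨?_, ?_⟩, fun htop => ⟨?_, ?_⟩, ?_⟩
  · rw [numSimM3_levelQuotient hq hi hl]
    simp only [sub_eq_add_neg, zpow_add₀ h0, zpow_neg, zpow_mul, zpow_natCast, zpow_ofNat]
    ring
  · rw [numSimGL3_levelQuotient hq hi hl]
    simp only [sub_eq_add_neg, zpow_add₀ h0, zpow_neg, zpow_mul, zpow_natCast, zpow_ofNat]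
    ring
  · ext n
    rw [PowerSeries.coeff_mk, PowerSeries.coeff_C_mul, map_add (PowerSeries.coeff n),
      map_sub (PowerSeries.coeff n), PowerSeries.coeff_C_mul, PowerSeries.coeff_C_mul,
      PowerSeries.coeff_C_mul, coeff_geomSeries, coeff_geomSeries, coeff_geomSeries]
    -- The closed formula is available only for `n ≥ 1`: the quotient at `n = 0` is the zero ring,
    -- which is not local.
    rcases Nat.eq_zero_or_pos n with rfl | hn
    · rw [numSimM3_levelQuotient_zero]
      push_cast
      field_simp
      ring
    · rw [numSimM3_levelQuotient hq hn (by rw [htop]; exact le_top)]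
      ring
  · ext n
    rw [PowerSeries.coeff_mk, PowerSeries.coeff_C_mul, map_add (PowerSeries.coeff n),
      map_sub (PowerSeries.coeff n), PowerSeries.coeff_C_mul, PowerSeries.coeff_C_mul,
      PowerSeries.coeff_C_mul, coeff_geomSeries, coeff_geomSeries, coeff_geomSeries]
    rcases Nat.eq_zero_or_pos n with rfl | hn
    · rw [if_pos rfl]
      field_simp
      ring
    · rw [if_neg hn.ne', numSimGL3_levelQuotient hq hn (by rw [htop]; exact le_top)]
      ring
  · intro B _ _ _ hB i hi hA hlB
    have : Finite (IsLocalRing.ResidueField B) :=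
      Nat.finite_of_card_ne_zero (by rw [hB]; exact_mod_cast h0)
    constructor
    · have : (numSimM3 (LevelQuotient A i) : ℚ) = numSimM3 (LevelQuotient B i) := by
        rw [numSimM3_levelQuotient hq hi hA, numSimM3_levelQuotient hB hi hlB]
      exact_mod_cast this
    · have : (numSimGL3 (LevelQuotient A i) : ℚ) = numSimGL3 (LevelQuotient B i) := by
        rw [numSimGL3_levelQuotient hq hi hA, numSimGL3_levelQuotient hB hi hlB]
      exact_mod_cast this
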